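/- Let $n\ge 2$ and let $T_n$ be the tree all of whose vertices have valence $n+1$. A way in $T_n$ is a sequence of vertices $(a_i)_{i\ge 0}$ with $a_i,a_{i+1}$ adjacent and $a_{i+2}\neq a_i$; two ways are equivalent if, after a shift of the numbering, they eventually coincide; the boundary $\mathrm{Abs}(T_n)$ is the set of equivalence classes. Cutting an edge at its midpoint gives two branches; the ball of a branch $U$ is the set of boundary points represented by ways in $U$, and the balls generate the topology of $\mathrm{Abs}(T_n)$. Let $\mathrm{Hier}(T_n)$ be the group of homeomorphisms of $\mathrm{Abs}(T_n)$ that coincide in a neighbourhood of each point with an element of $\mathrm{Aut}(T_n)$; it contains $\mathrm{Aut}(T_n)$ as a subgroup. An element $g\in\mathrm{Hier}(T_n)$ regards a ball $B$ with branch $U$ if $gB$ is a ball, with branch $V$ say, and $g:B\to gB$ is induced by an isomorphism of branches $U\to V$. A perfect thorn $R$ is either empty or a finite tree with at least three points, each of valence $1$ or $n+1$; the points of valence $1$ are called spikes and the others vertices. A bi-thorn $\{R,Q;\theta\}$ is an ordered pair of perfect thorns with the same number of vertices, together with a bijection $\theta$ from the spikes of $R$ to the spikes of $Q$; the empty bi-thorn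 is allowed. Bi-thorns are considered up to isomorphism (a pair of isomorphisms of trees $R\to R'$, $Q\to Q'$ compatible with $\theta,\theta'$). Vertices $a$ of $R$ and $b$ of $Q$ are similar if each of them is adjacent to at most one other vertex of its thorn and $\theta$ sends all spikes at $a$ to spikes at $b$. A bi-thorn is minimal if it has no pair of similar vertices. Proposition. There is a unique bijection $$\Phi:\ \mathrm{Aut}(T_n)\backslash \mathrm{Hier}(T_n)/\mathrm{Aut}(T_n)\ \longrightarrow\ \{\text{isomorphism classes of minimal bi-thorns}\}$$ such that, for every $g\in\mathrm{Hier}(T_n)$ and every minimal bi-thorn $\{R,Q;\theta\}$, the double coset of $g$ is mapped to the class of $\{R,Q;\theta\}$ if and only if $R$ and $Q$ can be embedded in $T_n$ (with a spike attached to a vertex going to the midpoint of an edge at the image of that vertex, and so determining the branch behind this midpoint and its ball) in such a way that the balls determined by the spikes of $R$ are exactly the maximal balls regarded by $g$, and for each spike $s$ of $R$ the ball of $s$ is mapped by $g$ onto the ball of the spike $\theta(s)$ of $Q$. (For $g\in\mathrm{Aut}(T_n)$ there are no maximal regarded balls, and the bi-thorn is empty.) -/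

import Mathlib

open Topology

noncomputable section

namespace Spheromorphism

/-! ### The boundary of a tree -/

section Boundary

variable {V : Type*}

/-- A way: a sequence of successively adjacent vertices without backtracking. -/
def IsWay (T : SimpleGraph V) (a : ℕ → V) : Prop :=
  (∀ i, T.Adj (a i) (a (i + 1))) ∧ ∀ i, a (i + 2) ≠ a i

/-- The type of ways in `T`. -/
def Way (T : SimpleGraph V) : Type _ := {a : ℕ → V // IsWay T a}

/-- Two ways are equivalent if, up to a shift of the numbering, they eventually coincide. -/
def wayEquiv (T : SimpleGraph V) (a b : Way T) : Prop :=
  ∃ k l : ℕ, ∀ i, a.1 (i + k) = b.1 (i + l)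

/-- Equivalence of ways as a setoid. -/
abbrev waySetoid (T : SimpleGraph V) : Setoid (Way T) where
  r := wayEquiv T
  iseqv :=
    { refl := fun _ => ⟨0, 0, fun _ => rfl⟩
      symm := fun ⟨k, l, h⟩ => ⟨l, k, fun i => (h i).symm⟩
      trans := by
        rintro a b c ⟨k, l, h⟩ ⟨k', l', h'⟩
        refine ⟨k' + k, l + l', fun i => ?_⟩
        have h1 := h (i + k')
        have h2 := h' (i + l)
        have e : i + k' + l = i + l + k' := by omega
        rw [e] at h1
        rw [← add_assoc, ← add_assoc, h1, h2] }

/-- The boundary `Abs(T)`: classes of equivalent ways. -/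
def Bdry (T : SimpleGraph V) : Type _ := Quotient (waySetoid T)

/-- The boundary point defined by a way. -/
def Bdry.mk {T : SimpleGraph V} (a : Way T) : Bdry T := Quotient.mk (waySetoid T) a

/-- Cut the edge `pq` in the middle: the (vertex set of the) branch that contains `q`. -/
def branch (T : SimpleGraph V) (p q : V) : Set V :=
  {v | (T.deleteEdges {s(p, q)}).Reachable q v}

/-- The ball `Ba[U]`, where `U` is the branch at `pq` containing `q`: the boundary points given by
ways that lie in `U`. -/
def ball (T : SimpleGraph V) (p q : V) : Set (Bdry T) :=
  {x | ∃ a : Way T, (∀ i, a.1 i ∈ branch T p q) ∧ Bdry.mk a = x}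

/-- The topology of the boundary, generated by the balls. The complement of a ball in the boundary
of a tree is the ball of the complementary branch, so balls are clopen. -/
instance (T : SimpleGraph V) : TopologicalSpace (Bdry T) :=
  TopologicalSpace.generateFrom {B | ∃ p q, T.Adj p q ∧ B = ball T p q}

/-! ### Automorphisms and spheromorphisms -/

/-- The image of a way under an automorphism. -/
def Way.map {T : SimpleGraph V} (r : T ≃g T) (a : Way T) : Way T :=
  ⟨fun i => r (a.1 i), fun i => r.map_adj_iff.2 (a.2.1 i), fun i h => a.2.2 i (r.injective h)⟩

/-- The map of the boundary induced by an automorphism. -/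
def bdryMap {T : SimpleGraph V} (r : T ≃g T) : Bdry T → Bdry T :=
  Quotient.map (Way.map r) (by
    rintro a b ⟨k, l, h⟩
    exact ⟨k, l, fun i => congrArg r (h i)⟩)

theorem bdryMap_one {T : SimpleGraph V} (x : Bdry T) : bdryMap (1 : T ≃g T) x = x := by
  induction x using Quotient.inductionOn with
  | h a => rfl

theorem bdryMap_mul {T : SimpleGraph V} (r s : T ≃g T) (x : Bdry T) :
    bdryMap (r * s) x = bdryMap r (bdryMap s x) := by
  induction x using Quotient.inductionOn with
  | h a => rfl

theorem mem_branch_map {T : SimpleGraph V} (r : T ≃g T) {p q v : V} (h : v ∈ branch T p q) :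
    r v ∈ branch T (r p) (r q) := by
  let f : T.deleteEdges {s(p, q)} →g T.deleteEdges {s(r p, r q)} :=
    { toFun := r
      map_rel' := by
        intro a b hab
        rw [SimpleGraph.deleteEdges_adj] at hab ⊢
        refine ⟨r.map_adj_iff.2 hab.1, fun h' => hab.2 ?_⟩
        simpa [Sym2.eq_iff] using h' }
  exact SimpleGraph.Reachable.map f h

theorem bdryMap_mem_ball {T : SimpleGraph V} (r : T ≃g T) {p q : V} {x : Bdry T}
    (h : x ∈ ball T p q) : bdryMap r x ∈ ball T (r p) (r q) := by
  obtain ⟨a, ha, rfl⟩ := h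
  exact ⟨a.map r, fun i => mem_branch_map r (ha i), rfl⟩

theorem continuous_bdryMap {T : SimpleGraph V} (r : T ≃g T) : Continuous (bdryMap r) := by
  refine continuous_generateFrom_iff.2 ?_
  rintro _ ⟨p, q, hpq, rfl⟩
  refine TopologicalSpace.isOpen_generateFrom_of_mem
    ⟨r⁻¹ p, r⁻¹ q, (r⁻¹).map_adj_iff.2 hpq, ?_⟩
  ext x
  constructor
  · intro hx
    have h := bdryMap_mem_ball r⁻¹ hx
    rwa [← bdryMap_mul, inv_mul_cancel, bdryMap_one] at h
  · intro hx
    have h := bdryMap_mem_ball r hx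
    rwa [RelIso.apply_inv_self, RelIso.apply_inv_self] at h

/-- The action of `Aut(T)` on the boundary by homeomorphisms. -/
def autBdry (T : SimpleGraph V) : (T ≃g T) →* (Bdry T ≃ₜ Bdry T) where
  toFun r :=
    { toFun := bdryMap r
      invFun := bdryMap r⁻¹
      left_inv := fun x => by rw [← bdryMap_mul, inv_mul_cancel, bdryMap_one]
      right_inv := fun x => by rw [← bdryMap_mul, mul_inv_cancel, bdryMap_one]
      continuous_toFun := continuous_bdryMap r
      continuous_invFun := continuous_bdryMap r⁻¹ }
  map_one' := by ext x; exact bdryMap_one x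
  map_mul' r s := by ext x; exact bdryMap_mul r s x

/-- The group `Hier(T)` of spheromorphisms: the homeomorphisms of the boundary that coincide with
an automorphism of `T` in a neighbourhood of each point. -/
def Hier (T : SimpleGraph V) : Subgroup (Bdry T ≃ₜ Bdry T) where
  carrier := {g | ∀ y, ∃ N ∈ 𝓝 y, ∃ r : T ≃g T, ∀ x ∈ N, g x = autBdry T r x}
  one_mem' := fun _ => ⟨Set.univ, Filter.univ_mem, 1, fun x _ => (bdryMap_one x).symm⟩
  mul_mem' := by
    intro g h hg hh y
    obtain ⟨N, hN, r, hr⟩ := hh y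
    obtain ⟨M, hM, s, hs⟩ := hg (h y)
    refine ⟨N ∩ h ⁻¹' M, Filter.inter_mem hN (h.continuous.continuousAt hM), s * r, ?_⟩
    rintro x ⟨hxN, hxM⟩
    rw [map_mul]
    change g (h x) = autBdry T s (autBdry T r x)
    rw [hs _ hxM, hr _ hxN]
  inv_mem' := by
    intro g hg y
    obtain ⟨N, hN, r, hr⟩ := hg (g.symm y)
    refine ⟨g.symm ⁻¹' N, g.symm.continuous.continuousAt hN, r⁻¹, ?_⟩
    intro x hx
    have h := hr _ hx
    rw [g.apply_symm_apply] at h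
    change g.symm x = bdryMap r⁻¹ x
    change x = bdryMap r (g.symm x) at h
    conv_rhs => rw [h]
    rw [← bdryMap_mul, inv_mul_cancel, bdryMap_one]

/-- `Aut(T)` as a subgroup of `Hier(T)`: the spheromorphisms induced by automorphisms. -/
def AutSubgroup (T : SimpleGraph V) : Subgroup (Hier T) :=
  (autBdry T).range.subgroupOf (Hier T)

/-- `g` regards the ball of the branch `U` at `pq` with image the ball of the branch `U'` at
`p'q'`: `g` maps the first ball onto the second one, and this map is induced by an isomorphism `φ`
of the branches, i.e. a way `a` in `U` and its image `b = φ ∘ a` satisfy `g [a] = [b]`. -/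
def RegardsTo (T : SimpleGraph V) (g : Bdry T ≃ₜ Bdry T) (p q p' q' : V) : Prop :=
  g '' ball T p q = ball T p' q' ∧
    ∃ φ : T.induce (branch T p q) ≃g T.induce (branch T p' q'),
      ∀ a b : Way T,
        (∀ i, ∃ h : a.1 i ∈ branch T p q, b.1 i = φ ⟨a.1 i, h⟩) → g (Bdry.mk a) = Bdry.mk b

/-- `B` is a ball regarded by `g`. -/
def Regards (T : SimpleGraph V) (g : Bdry T ≃ₜ Bdry T) (B : Set (Bdry T)) : Prop :=
  ∃ p q p' q', T.Adj p q ∧ T.Adj p' q' ∧ B = ball T p q ∧ RegardsTo T g p q p' q'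

end Boundary

/-! ### Thorns and bi-thorns -/

/-- The valence of a vertex. -/
def valence {W : Type*} (G : SimpleGraph W) (v : W) : ℕ := (G.neighborSet v).ncard

theorem valence_iso {W W' : Type*} {G : SimpleGraph W} {G' : SimpleGraph W'} (f : G ≃g G')
    (v : W) : valence G' (f v) = valence G v :=
  (Nat.card_congr (f.mapNeighborSet v)).symm

/-- A thorn (for the tree of valence `n + 1`): a finite tree with at least three vertices, all of
valence at most `n + 1`, or the empty thorn. (The exceptional thorn with one vertex and one spike
is never perfect for `n ≥ 1` and is not needed.) -/
structure Thorn (n : ℕ) where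
  /-- The vertices of the underlying tree, i.e. the vertices and the spikes of the thorn. -/
  carrier : Type
  /-- The underlying tree. -/
  graph : SimpleGraph carrier
  finite : Finite carrier
  isThorn : IsEmpty carrier ∨
    (graph.IsTree ∧ 3 ≤ Nat.card carrier ∧ ∀ v, valence graph v ≤ n + 1)

namespace Thorn

variable {n : ℕ}

/-- The spikes of a thorn: the points of valence 1 of the underlying tree. -/
def Spike (R : Thorn n) : Type := {s : R.carrier // valence R.graph s = 1}

/-- The vertices of a thorn: the other points, which span the skeleton. -/
def Vert (R : Thorn n) : Type := {v : R.carrier // valence R.graph v ≠ 1}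

/-- A thorn is perfect if all its vertices have valence `n + 1`. -/
def IsPerfect (R : Thorn n) : Prop := ∀ v : R.Vert, valence R.graph v.1 = n + 1

/-- The skeleton of a thorn. -/
def skeleton (R : Thorn n) : SimpleGraph R.Vert := R.graph.comap Subtype.val

/-- The vertex `a` has at most one neighbour in the skeleton: it is a boundary vertex of the
skeleton, or the only vertex of the thorn. -/
def IsTerminal (R : Thorn n) (a : R.Vert) : Prop := valence R.skeleton a ≤ 1

/-- An isomorphism of thorns maps spikes to spikes. -/
def spikeMap {R R' : Thorn n} (f : R.graph ≃g R'.graph) (s : R.Spike) : R'.Spike :=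
  ⟨f s.1, (valence_iso f s.1).trans s.2⟩

end Thorn

/-- A bi-thorn: an ordered pair of perfect thorns with the same number of vertices and a bijection
of their spikes. -/
structure BiThorn (n : ℕ) where
  R : Thorn n
  Q : Thorn n
  perfect_R : R.IsPerfect
  perfect_Q : Q.IsPerfect
  card_eq : Nat.card R.Vert = Nat.card Q.Vert
  θ : R.Spike ≃ Q.Spike

namespace BiThorn

variable {n : ℕ}

/-- Similar vertices: terminal vertices `a` of `R` and `b` of `Q` such that `θ` sends all spikes
at `a` to spikes at `b`. -/
def Similar (β : BiThorn n) (a : β.R.Vert) (b : β.Q.Vert) : Prop :=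
  β.R.IsTerminal a ∧ β.Q.IsTerminal b ∧
    ∀ s : β.R.Spike, β.R.graph.Adj a.1 s.1 → β.Q.graph.Adj b.1 (β.θ s).1

/-- A bi-thorn is minimal if it has no pair of similar vertices. -/
def IsMinimal (β : BiThorn n) : Prop := ∀ a b, ¬ β.Similar a b

/-- Isomorphism of bi-thorns: isomorphisms of the two thorns compatible with the bijections of
the spikes. -/
def Isomorphic (β β' : BiThorn n) : Prop :=
  ∃ (f : β.R.graph ≃g β'.R.graph) (h : β.Q.graph ≃g β'.Q.graph),
    ∀ s, Thorn.spikeMap h (β.θ s) = β'.θ (Thorn.spikeMap f s)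

theorem isomorphic_equivalence : Equivalence (Isomorphic (n := n)) where
  refl β := ⟨.refl, .refl, fun _ => rfl⟩
  symm := by
    rintro β β' ⟨f, h, H⟩
    refine ⟨f.symm, h.symm, fun s => ?_⟩
    have h1 := H (Thorn.spikeMap f.symm s)
    have h2 : Thorn.spikeMap f (Thorn.spikeMap f.symm s) = s :=
      Subtype.ext (f.apply_symm_apply s.1)
    rw [h2] at h1
    rw [← h1]
    exact Subtype.ext (h.symm_apply_apply _)
  trans := by
    rintro β β' β'' ⟨f, h, H⟩ ⟨f', h', H'⟩
    refine ⟨f.trans f', h.trans h', fun s => ?_⟩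
    change Thorn.spikeMap h' (Thorn.spikeMap h (β.θ s)) =
      β''.θ (Thorn.spikeMap f' (Thorn.spikeMap f s))
    rw [H, H']

end BiThorn

/-- Isomorphism of minimal bi-thorns as a setoid. -/
abbrev minimalSetoid (n : ℕ) : Setoid {β : BiThorn n // β.IsMinimal} :=
  Setoid.comap Subtype.val ⟨BiThorn.Isomorphic, BiThorn.isomorphic_equivalence⟩

/-- The set of minimal bi-thorns, considered up to isomorphism. -/
def MinimalBiThorn (n : ℕ) : Type 1 := Quotient (minimalSetoid n)

/-- The class of a minimal bi-thorn. -/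
def MinimalBiThorn.mk {n : ℕ} (β : BiThorn n) (hβ : β.IsMinimal) : MinimalBiThorn n :=
  Quotient.mk (minimalSetoid n) ⟨β, hβ⟩

/-- `β = {R, Q; θ}` is the bi-thorn of `g`: `R` and `Q` can be embedded in `T` as sub-thorns (a
spike `s` at a vertex `v` goes to the middle of the edge `(f v)(f s)`, so that it determines the
branch behind this point) in such a way that the balls of the spikes of `R` are exactly the maximal
balls regarded by `g`, and `g` maps the ball of a spike `s` of `R` to the ball of the spike `θ s`
of `Q`. -/
def IsBiThornOf {V : Type*} {T : SimpleGraph V} {n : ℕ} (g : Bdry T ≃ₜ Bdry T)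
    (β : BiThorn n) : Prop :=
  ∃ (f : β.R.graph ↪g T) (h : β.Q.graph ↪g T),
    (∀ B : Set (Bdry T), Maximal (Regards T g) B ↔
      ∃ (v : β.R.Vert) (s : β.R.Spike), β.R.graph.Adj v.1 s.1 ∧ B = ball T (f v.1) (f s.1)) ∧
    ∀ (v : β.R.Vert) (s : β.R.Spike) (w : β.Q.Vert), β.R.graph.Adj v.1 s.1 →
      β.Q.graph.Adj w.1 (β.θ s).1 →
        g '' ball T (f v.1) (f s.1) = ball T (h w.1) (h (β.θ s).1)

end Spheromorphism

end

/-!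
A regular tree is homogeneous in a strong sense: an injective homomorphism from a nonempty convex
set of vertices to the tree extends to an automorphism (`exists_iso_extending`; the maximal partial
extension given by Zorn's lemma is everywhere defined, because the tree has no cycles and the
valences are constant). In particular `g` regards the ball of a branch if and only if it coincides
on this ball with an automorphism of the whole tree (`regards_iff`), so balls inside regarded balls
are regarded, and if both halves of an edge are regarded, then `g` is an automorphism
(`isAut_of_agreesOn`).

Let `g` be a spheromorphism that is not an automorphism. Its `core` consists of the vertices that
are not in the branch of any regarded ball. It is convex; it is finite by König's argument and
nonempty, both because along each way the balls are eventually regarded; and the edges that leave it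
are those of the maximal regarded balls (`maximal_regards_iff`). Hence the core with these edges is
a perfect thorn `R`. The same construction for `g⁻¹` gives `Q`, and `g` matches the spikes; the
numbers of vertices agree as they are determined by the numbers of spikes (`Thorn.card_spike`). This
bi-thorn is minimal: at a pair of similar vertices the automorphisms behind the spikes could be
glued to one on a larger branch (`isMinimal_of_isBiThornOf`). It is unique up to isomorphism, as an
embedded thorn is determined by the balls of its spikes (`exists_iso_of_spikeBall`), and it depends
only on the double coset (`isBiThornOf_comp`).

If `g` and `g'` have the same bi-thorn, then automorphisms that move the embeddings of one to those
of the other reduce the claim to the case that `g⁻¹ g'` preserves the ball of each spike and acts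
there by an automorphism; these automorphisms glue to one of the tree
(`exists_comp_of_isBiThornOf`). Conversely, given a minimal bi-thorn, embed both thorns and glue
automorphisms that carry the ball of `s` to the ball of `θ s`. If the result regarded a branch that
contains a vertex of `R`, then an outermost vertex of `R` in this branch and its image would be
similar (`notMem_branch_of_isMinimal`), so the maximal regarded balls are those of the spikes.
-/

namespace Spheromorphism

/-! ### Branches and convex sets of vertices -/

section Tree

variable {V : Type*} {T : SimpleGraph V}

theorem mem_branch_self (p q : V) : q ∈ branch T p q := SimpleGraph.Reachable.refl _

theorem mem_branch_of_adj {p q u w : V} (hu : u ∈ branch T p q) (h : T.Adj u w)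
    (hne : s(u, w) ≠ s(p, q)) : w ∈ branch T p q :=
  SimpleGraph.Reachable.trans hu
    (SimpleGraph.Adj.reachable (by rw [SimpleGraph.deleteEdges_adj]; exact ⟨h, by simpa using hne⟩))

theorem notMem_branch (hT : T.IsTree) {p q : V} (h : T.Adj p q) : p ∉ branch T p q := by
  have := SimpleGraph.isAcyclic_iff_forall_adj_isBridge.1 hT.isAcyclic h
  rw [SimpleGraph.isBridge_iff] at this
  exact fun h' => this h'.symm

/-- The only edge that leaves a branch is the one that was cut. -/
theorem branch_exit (hT : T.IsTree) {p q u w : V} (hpq : T.Adj p q) (hu : u ∈ branch T p q)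
    (hw : w ∉ branch T p q) (h : T.Adj u w) : u = q ∧ w = p := by
  by_cases hne : s(u, w) = s(p, q)
  · rcases Sym2.eq_iff.1 hne with ⟨rfl, rfl⟩ | ⟨rfl, rfl⟩
    · exact absurd hu (notMem_branch hT hpq)
    · exact ⟨rfl, rfl⟩
  · exact absurd (mem_branch_of_adj hu h hne) hw

/-- In a connected graph, a property that passes to neighbours holds everywhere. -/
theorem preconnected_induction {W : Type*} {G : SimpleGraph W} (hG : G.Preconnected) {P : W → Prop}
    (u : W) (hu : P u) (step : ∀ v w, P v → G.Adj v w → P w) (w : W) : P w := by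
  have h := (SimpleGraph.reachable_iff_reflTransGen u w).1 (hG u w)
  induction h with
  | refl => exact hu
  | tail _ h ih => exact step _ _ ih h

theorem branch_induction {p q y : V} {P : V → Prop} (hy : y ∈ branch T p q) (hP : P y)
    (step : ∀ u w, u ∈ branch T p q → w ∈ branch T p q → T.Adj u w → P u → P w) :
    ∀ z ∈ branch T p q, P z := by
  intro z hz
  have h := (SimpleGraph.reachable_iff_reflTransGen y z).1 (hy.symm.trans hz)
  suffices z ∈ branch T p q ∧ P z from this.2
  clear hz
  induction h with
  | refl => exact ⟨hy, hP⟩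
  | tail _ h ih =>
    have hb := SimpleGraph.Reachable.trans ih.1 h.reachable
    exact ⟨hb, step _ _ ih.1 hb (SimpleGraph.deleteEdges_le _ h) ih.2⟩

/-- A branch that meets a second one and avoids the point behind it is contained in it. -/
theorem branch_subset (hT : T.IsTree) {p q p' q' y : V} (h' : T.Adj p' q')
    (hp' : p' ∉ branch T p q) (hy : y ∈ branch T p q) (hy' : y ∈ branch T p' q') :
    branch T p q ⊆ branch T p' q' := by
  refine branch_induction hy hy' fun u w _ hw hadj hu' => ?_
  by_contra hw'
  exact hp' ((branch_exit hT h' hu' hw' hadj).2 ▸ hw)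

theorem mem_branch_or (hT : T.IsTree) (p q x : V) : x ∈ branch T p q ∨ x ∈ branch T q p := by
  refine preconnected_induction hT.connected.preconnected
    (P := fun x => x ∈ branch T p q ∨ x ∈ branch T q p) q (Or.inl (mem_branch_self p q)) ?_ x
  intro v w hv hvw
  by_cases hne : s(v, w) = s(p, q)
  · rcases Sym2.eq_iff.1 hne with ⟨rfl, rfl⟩ | ⟨rfl, rfl⟩
    · exact Or.inl (mem_branch_self _ _)
    · exact Or.inr (mem_branch_self _ _)
  · exact hv.imp (fun h => mem_branch_of_adj h hvw hne)
      (fun h => mem_branch_of_adj h hvw (by rwa [Sym2.eq_swap (a := q)]))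

theorem notMem_branch_iff (hT : T.IsTree) {p q : V} (h : T.Adj p q) {x : V} :
    x ∉ branch T p q ↔ x ∈ branch T q p := by
  refine ⟨(mem_branch_or hT p q x).resolve_left, fun h1 h2 => notMem_branch hT h ?_⟩
  have e : T.deleteEdges {s(q, p)} = T.deleteEdges {s(p, q)} := by rw [Sym2.eq_swap]
  have h1' : (T.deleteEdges {s(p, q)}).Reachable p x := e ▸ h1
  exact SimpleGraph.Reachable.trans h2 h1'.symm

theorem mem_branch_symm (hT : T.IsTree) {p q : V} {x : V} (hx : x ∉ branch T p q) :
    x ∈ branch T q p := (mem_branch_or hT p q x).resolve_left hx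

theorem branch_nested (hT : T.IsTree) {p q r : V} (hpq : T.Adj p q) (hqr : T.Adj q r)
    (hne : r ≠ p) : branch T q r ⊆ branch T p q := by
  refine branch_subset hT hpq (fun h => ?_) (mem_branch_self q r)
    (mem_branch_of_adj (mem_branch_self p q) hqr ?_)
  · exact hne (branch_exit hT hqr h (notMem_branch hT hqr) hpq).1.symm
  · intro h
    rcases Sym2.eq_iff.1 h with ⟨rfl, rfl⟩ | ⟨-, rfl⟩
    · exact hpq.ne rfl
    · exact hne rfl

theorem branch_inj (hT : T.IsTree) {p q p' q' : V} (h : T.Adj p q) (h' : T.Adj p' q')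
    (e : branch T p q = branch T p' q') : p = p' ∧ q = q' := by
  have := branch_exit hT h' (e ▸ mem_branch_self p q) (e ▸ notMem_branch hT h) h.symm
  exact ⟨this.2, this.1⟩

/-- A vertex of a branch, other than its root, lies behind a neighbour of the root. -/
theorem exists_mem_branch_of_mem (hT : T.IsTree) {p q y : V} (hpq : T.Adj p q)
    (hy : y ∈ branch T p q) : y = q ∨ ∃ x, T.Adj q x ∧ x ≠ p ∧ y ∈ branch T q x := by
  refine branch_induction (P := fun y => y = q ∨ ∃ x, T.Adj q x ∧ x ≠ p ∧ y ∈ branch T q x)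
    (mem_branch_self p q) (Or.inl rfl) ?_ y hy
  rintro u w - hw huw (rfl | ⟨x, hx, hxp, hu⟩)
  · exact Or.inr ⟨w, huw, fun h => notMem_branch hT hpq (h ▸ hw), mem_branch_self _ _⟩
  · by_cases hwx : w ∈ branch T q x
    · exact Or.inr ⟨x, hx, hxp, hwx⟩
    · exact Or.inl (branch_exit hT hx hu hwx huw).2

/-- A point outside a set of vertices lies behind some edge that leaves this set. -/
theorem exists_exit (hT : T.IsTree) {A : Set V} (hA : A.Nonempty) {y : V} (hy : y ∉ A) :
    ∃ v ∈ A, ∃ x ∉ A, T.Adj v x ∧ y ∈ branch T v x := by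
  obtain ⟨v, hv⟩ := hA
  revert hy
  refine preconnected_induction hT.connected.preconnected
    (P := fun y => y ∉ A → ∃ v ∈ A, ∃ x ∉ A, T.Adj v x ∧ y ∈ branch T v x) v
    (fun h => absurd hv h) ?_ y
  intro u w ih huw hw
  by_cases hu : u ∈ A
  · exact ⟨u, hu, w, hw, huw, mem_branch_self _ _⟩
  · obtain ⟨a, ha, x, hx, hax, hb⟩ := ih hu
    refine ⟨a, ha, x, hx, hax, ?_⟩
    by_contra hwb
    exact hw ((branch_exit hT hax hb hwb huw).2 ▸ ha)

theorem exists_adj_branch (hT : T.IsTree) {y p : V} (h : p ≠ y) :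
    ∃ y', T.Adj y y' ∧ p ∈ branch T y y' := by
  obtain ⟨v, rfl, x, -, h1, h2⟩ := exists_exit hT (A := {y}) ⟨y, rfl⟩ h
  exact ⟨x, h1, h2⟩

/-- Every vertex of a branch is the root of a branch inside this branch. -/
theorem exists_subbranch (hT : T.IsTree) {p q y : V} (hpq : T.Adj p q) (hy : y ∈ branch T p q) :
    ∃ y', T.Adj y' y ∧ branch T y' y ⊆ branch T p q := by
  obtain ⟨y', h1, h2⟩ := exists_adj_branch hT (p := p) (y := y)
    (fun h => notMem_branch hT hpq (h ▸ hy))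
  exact ⟨y', h1.symm, branch_subset hT hpq ((notMem_branch_iff hT h1.symm).2 h2)
    (mem_branch_self _ _) hy⟩

/-- A set of vertices is convex if, for each edge leaving it, it lies entirely on the inner side
of this edge; if it is not empty, this says that it spans a subtree. -/
def IsConvex (T : SimpleGraph V) (S : Set V) : Prop :=
  ∀ v ∈ S, ∀ x ∉ S, T.Adj v x → S ⊆ branch T x v

theorem IsConvex.singleton (v : V) : IsConvex T {v} := by
  rintro _ rfl x - - _ rfl
  exact mem_branch_self _ _

theorem isConvex_branch (hT : T.IsTree) {p q : V} (h : T.Adj p q) :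
    IsConvex T (branch T p q) := by
  intro v hv x hx hvx
  obtain ⟨rfl, rfl⟩ := branch_exit hT h hv hx hvx
  exact subset_rfl

theorem IsConvex.pair {p q : V} (h : T.Adj p q) : IsConvex T {p, q} := by
  rintro v hv x hx - y hy
  simp only [Set.mem_insert_iff, Set.mem_singleton_iff, not_or] at hv hx hy
  have hvb := mem_branch_self (T := T) x v
  by_cases hyv : y = v
  · rwa [hyv]
  · refine mem_branch_of_adj hvb ?_ ?_
    · rcases hv with rfl | rfl <;> rcases hy with rfl | rfl
      · exact absurd rfl hyv
      · exact h
      · exact h.symm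
      · exact absurd rfl hyv
    · intro e
      rcases Sym2.eq_iff.1 e with ⟨rfl, -⟩ | ⟨-, rfl⟩
      · exact hv.elim hx.1 hx.2
      · exact hy.elim hx.1 hx.2

/-- Two neighbours in a convex set of a point outside it are equal. -/
theorem IsConvex.adj_unique (hT : T.IsTree) {S : Set V} (hS : IsConvex T S) {x v v' : V}
    (hx : x ∉ S) (hv : v ∈ S) (hv' : v' ∈ S) (h : T.Adj v x) (h' : T.Adj v' x) : v' = v :=
  (branch_exit hT h.symm (hS v hv x hx h hv') (notMem_branch hT h.symm) h').1

/-- Distinct edges that leave a convex set lead to disjoint branches. -/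
theorem IsConvex.exit_unique (hT : T.IsTree) {S : Set V} (hS : IsConvex T S) {v x v' x' y : V}
    (hv : v ∈ S) (hx : x ∉ S) (h : T.Adj v x) (hv' : v' ∈ S) (hx' : x' ∉ S) (h' : T.Adj v' x')
    (hy : y ∈ branch T v x) (hy' : y ∈ branch T v' x') : v = v' ∧ x = x' := by
  refine branch_inj hT h h' (Set.Subset.antisymm ?_ ?_)
  · exact branch_subset hT h' ((notMem_branch_iff hT h).2 (hS v hv x hx h hv')) hy hy'
  · exact branch_subset hT h ((notMem_branch_iff hT h').2 (hS v' hv' x' hx' h' hv)) hy' hy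

theorem IsConvex.insert (hT : T.IsTree) {S : Set V} (hS : IsConvex T S) {v x : V}
    (hv : v ∈ S) (hx : x ∉ S) (h : T.Adj v x) : IsConvex T (insert x S) := by
  intro u hu y hy huy
  rw [Set.mem_insert_iff, not_or] at hy
  rcases hu with rfl | hu
  · have hvy : y ≠ v := fun e => hy.2 (e ▸ hv)
    rintro z (rfl | hz)
    · exact mem_branch_self _ _
    · exact branch_nested hT huy.symm h.symm hvy.symm (hS v hv u hx h hz)
  · rintro z (rfl | hz)
    · by_contra hz
      exact hy.1 (branch_exit hT huy.symm (hS u hu y hy.2 huy hv) hz h).2.symm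
    · exact hS u hu y hy.2 huy hz

theorem IsConvex.range {W : Type*} {G : SimpleGraph W} (hG : G.Preconnected) (hT : T.IsTree)
    (f : G →g T) : IsConvex T (Set.range f) := by
  rintro _ ⟨a, rfl⟩ x hx hax _ ⟨b, rfl⟩
  refine preconnected_induction hG (P := fun b => f b ∈ branch T x (f a)) a
    (mem_branch_self _ _) (fun u w hu huw => ?_) b
  by_contra hw
  exact hx ⟨w, (branch_exit hT hax.symm hu hw (f.map_adj huw)).2⟩

end Tree

/-! ### Extension of maps between trees -/

section Extension

variable {W V : Type*} {G : SimpleGraph W} {T : SimpleGraph V}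

theorem mem_branch_of_locallyInjective (hT : T.IsTree) (f : G →g T)
    (hf : ∀ w w₁ w₂, G.Adj w w₁ → G.Adj w w₂ → f w₁ = f w₂ → w₁ = w₂) {u u' v : W}
    (h : G.Adj u u') (p : G.Walk u' v) (hp : (SimpleGraph.Walk.cons h p).IsPath) :
    f v ∈ branch T (f u) (f u') := by
  induction p generalizing u with
  | nil => exact mem_branch_self _ _
  | @cons a b c h' p ih =>
    rw [SimpleGraph.Walk.cons_isPath_iff] at hp
    refine branch_nested hT (f.map_adj h) (f.map_adj h') (fun e => ?_) (ih h' hp.1)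
    refine hp.2 ?_
    rw [hf _ _ _ h.symm h' e.symm, SimpleGraph.Walk.support_cons]
    exact List.mem_cons_of_mem _ (SimpleGraph.Walk.start_mem_support _)

/-- A locally injective homomorphism from a connected graph to a tree is an embedding: it maps
paths to sequences without backtracking. -/
theorem exists_embedding_of_locallyInjective (hG : G.Preconnected) (hT : T.IsTree) (f : G →g T)
    (hf : ∀ w w₁ w₂, G.Adj w w₁ → G.Adj w w₂ → f w₁ = f w₂ → w₁ = w₂) :
    ∃ F : G ↪g T, ∀ w, F w = f w := by
  have key : ∀ u v : W, u ≠ v → ∃ u', G.Adj u u' ∧ f v ∈ branch T (f u) (f u') := by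
    intro u v huv
    obtain ⟨p, hp⟩ := (hG u v).exists_isPath
    cases p with
    | nil => exact absurd rfl huv
    | cons h p => exact ⟨_, h, mem_branch_of_locallyInjective hT f hf h p hp⟩
  have inj : Function.Injective f := by
    intro u v e
    by_contra huv
    obtain ⟨u', h, hb⟩ := key u v huv
    exact notMem_branch hT (f.map_adj h) (e ▸ hb)
  refine ⟨⟨⟨f, inj⟩, fun {u v} => ⟨fun h => ?_, fun h => f.map_adj h⟩⟩, fun _ => rfl⟩
  have h : T.Adj (f u) (f v) := h
  obtain ⟨u', h1, hb⟩ := key u v (fun e => h.ne (congrArg f e))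
  rwa [inj (branch_exit hT (f.map_adj h1) hb (notMem_branch hT (f.map_adj h1)) h.symm).1]

/-- A set of pairs that is the graph of a locally injective homomorphism from a convex set of
vertices. -/
structure IsPartialImmersion (G : SimpleGraph W) (T : SimpleGraph V) (Γ : Set (W × V)) :
    Prop where
  convex : IsConvex G (Prod.fst '' Γ)
  func : ∀ w t t', (w, t) ∈ Γ → (w, t') ∈ Γ → t = t'
  hom : ∀ w t w' t', (w, t) ∈ Γ → (w', t') ∈ Γ → G.Adj w w' → T.Adj t t'
  inj : ∀ w w₁ w₂ t, w ∈ Prod.fst '' Γ → (w₁, t) ∈ Γ → (w₂, t) ∈ Γ → G.Adj w w₁ → G.Adj w w₂ →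
    w₁ = w₂

theorem IsPartialImmersion.sUnion {c : Set (Set (W × V))}
    (hc : ∀ Γ ∈ c, IsPartialImmersion G T Γ) (hchain : IsChain (· ⊆ ·) c) :
    IsPartialImmersion G T (⋃₀ c) := by
  have dir : ∀ x ∈ ⋃₀ c, ∀ y ∈ ⋃₀ c, ∃ Γ ∈ c, x ∈ Γ ∧ y ∈ Γ := by
    rintro x ⟨Γ, hΓ, hx⟩ y ⟨Γ', hΓ', hy⟩
    rcases hchain.total hΓ hΓ' with h | h
    · exact ⟨Γ', hΓ', h hx, hy⟩
    · exact ⟨Γ, hΓ, hx, h hy⟩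
  have dir3 : ∀ x ∈ ⋃₀ c, ∀ y ∈ ⋃₀ c, ∀ z ∈ ⋃₀ c, ∃ Γ ∈ c, x ∈ Γ ∧ y ∈ Γ ∧ z ∈ Γ := by
    rintro x hx y hy z ⟨Γ', hΓ', hz⟩
    obtain ⟨Γ, hΓ, hx, hy⟩ := dir x hx y hy
    rcases hchain.total hΓ hΓ' with h | h
    · exact ⟨Γ', hΓ', h hx, h hy, hz⟩
    · exact ⟨Γ, hΓ, hx, hy, h hz⟩
  refine ⟨?_, ?_, ?_, ?_⟩
  · rintro _ ⟨⟨v, t⟩, hv, rfl⟩ x hx hvx _ ⟨⟨y, t'⟩, hy, rfl⟩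
    obtain ⟨Γ, hΓ, h1, h2⟩ := dir _ hv _ hy
    refine (hc Γ hΓ).convex v ⟨_, h1, rfl⟩ x (fun h => hx ?_) hvx ⟨_, h2, rfl⟩
    obtain ⟨z, hz, e⟩ := h
    exact ⟨z, ⟨Γ, hΓ, hz⟩, e⟩
  · intro w t t' h h'
    obtain ⟨Γ, hΓ, h1, h2⟩ := dir _ h _ h'
    exact (hc Γ hΓ).func w t t' h1 h2
  · intro w t w' t' h h'
    obtain ⟨Γ, hΓ, h1, h2⟩ := dir _ h _ h'
    exact (hc Γ hΓ).hom w t w' t' h1 h2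
  · rintro _ w₁ w₂ t ⟨⟨w, t'⟩, hw, rfl⟩ h h'
    obtain ⟨Γ, hΓ, h1, h2, h3⟩ := dir3 _ hw _ h _ h'
    exact (hc Γ hΓ).inj w w₁ w₂ t ⟨_, h1, rfl⟩ h2 h3

theorem IsPartialImmersion.insert (hG : G.IsTree) {Γ : Set (W × V)}
    (hΓ : IsPartialImmersion G T Γ) {v x : W} {t y : V} (hv : (v, t) ∈ Γ)
    (hx : x ∉ Prod.fst '' Γ) (hvx : G.Adj v x) (hty : T.Adj t y)
    (hy : ∀ w, (w, y) ∈ Γ → ¬ G.Adj v w) : IsPartialImmersion G T (insert (x, y) Γ) := by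
  have hdom : Prod.fst '' (Insert.insert (x, y) Γ) = Insert.insert x (Prod.fst '' Γ) :=
    Set.image_insert_eq
  have hvd : v ∈ Prod.fst '' Γ := ⟨_, hv, rfl⟩
  have uniq : ∀ w s, (w, s) ∈ Γ → G.Adj w x → w = v := fun w s hw h =>
    hΓ.convex.adj_unique hG hx hvd ⟨_, hw, rfl⟩ hvx h
  refine ⟨?_, ?_, ?_, ?_⟩
  · rw [hdom]
    exact hΓ.convex.insert hG hvd hx hvx
  · rintro w s s' (h | h) (h' | h')
    · rw [Prod.mk.injEq] at h h'
      rw [h.2, h'.2]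
    · rw [Prod.mk.injEq] at h
      exact absurd ⟨_, h', h.1⟩ hx
    · rw [Prod.mk.injEq] at h'
      exact absurd ⟨_, h, h'.1⟩ hx
    · exact hΓ.func w s s' h h'
  · rintro w s w' s' (h | h) (h' | h') hadj
    · rw [Prod.mk.injEq] at h h'
      rw [h.1, h'.1] at hadj
      exact absurd rfl hadj.ne
    · rw [Prod.mk.injEq] at h
      obtain ⟨rfl, rfl⟩ := h
      obtain rfl := uniq _ _ h' hadj.symm
      rw [hΓ.func _ _ _ h' hv]
      exact hty.symm
    · rw [Prod.mk.injEq] at h'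
      obtain ⟨rfl, rfl⟩ := h'
      obtain rfl := uniq _ _ h hadj
      rw [hΓ.func _ _ _ h hv]
      exact hty
    · exact hΓ.hom w s w' s' h h' hadj
  · rintro w w₁ w₂ s hw h₁ h₂ a₁ a₂
    rw [hdom] at hw
    rcases hw with rfl | hw
    · rcases h₁ with h₁ | h₁
      · rw [Prod.mk.injEq] at h₁
        exact absurd h₁.1.symm a₁.ne
      rcases h₂ with h₂ | h₂
      · rw [Prod.mk.injEq] at h₂
        exact absurd h₂.1.symm a₂.ne
      rw [uniq _ _ h₁ a₁.symm, uniq _ _ h₂ a₂.symm]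
    · have main : ∀ w', (w', y) ∈ Γ → G.Adj w w' → G.Adj w x → False := by
        rintro w' h' a hax
        obtain ⟨⟨_, s'⟩, hw, rfl⟩ := hw
        obtain rfl := uniq _ _ hw hax
        exact hy w' h' a
      rcases h₁ with h₁ | h₁ <;> rcases h₂ with h₂ | h₂
      · rw [Prod.mk.injEq] at h₁ h₂
        rw [h₁.1, h₂.1]
      · rw [Prod.mk.injEq] at h₁
        obtain ⟨rfl, rfl⟩ := h₁
        exact (main _ h₂ a₂ a₁).elim
      · rw [Prod.mk.injEq] at h₂
        obtain ⟨rfl, rfl⟩ := h₂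
        exact (main _ h₁ a₁ a₂).elim
      · exact hΓ.inj w w₁ w₂ s hw h₁ h₂ a₁ a₂

/-- An injective homomorphism from a nonempty convex part of a tree `G` to a tree `T` extends to
an embedding of `G` if the valences of `T` are large enough. -/
theorem exists_embedding_extending (hG : G.IsTree) (hT : T.IsTree)
    (hfin : ∀ w, (G.neighborSet w).Finite) (hle : ∀ w t, valence G w ≤ valence T t)
    {S : Set W} (hS : IsConvex G S) (hne : S.Nonempty) (f : W → V)
    (hom : ∀ u ∈ S, ∀ w ∈ S, G.Adj u w → T.Adj (f u) (f w)) (inj : Set.InjOn f S) :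
    ∃ F : G ↪g T, ∀ w ∈ S, F w = f w := by
  have h0 : IsPartialImmersion G T ((fun w => (w, f w)) '' S) := by
    have hdom : Prod.fst '' ((fun w => (w, f w)) '' S) = S := by
      rw [Set.image_image]; simp
    refine ⟨by rwa [hdom], ?_, ?_, ?_⟩
    · rintro w t t' ⟨u, -, e⟩ ⟨u', -, e'⟩
      simp only [Prod.mk.injEq] at e e'
      rw [← e.2, ← e'.2, e.1, e'.1]
    · rintro w t w' t' ⟨u, hu, e⟩ ⟨u', hu', e'⟩ hadj
      simp only [Prod.mk.injEq] at e e'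
      obtain ⟨⟨rfl, rfl⟩, rfl, rfl⟩ := e, e'
      exact hom _ hu _ hu' hadj
    · rintro w w₁ w₂ t - ⟨u, hu, e⟩ ⟨u', hu', e'⟩ - -
      simp only [Prod.mk.injEq] at e e'
      rw [← e.1, ← e'.1]
      exact inj hu hu' (e.2.trans e'.2.symm)
  obtain ⟨Γ, hΓ0, hΓ⟩ := zorn_subset_nonempty {Γ | IsPartialImmersion G T Γ}
    (fun c hc hchain _ => ⟨⋃₀ c, IsPartialImmersion.sUnion (fun Γ h => hc h) hchain,
      fun s hs => Set.subset_sUnion_of_mem hs⟩) _ h0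
  have hP : IsPartialImmersion G T Γ := hΓ.prop
  have htot : ∀ w, ∃ t, (w, t) ∈ Γ := by
    by_contra hcon
    push Not at hcon
    obtain ⟨w, hw⟩ := hcon
    have hw' : w ∉ Prod.fst '' Γ := by
      rintro ⟨⟨a, t⟩, h, rfl⟩
      exact hw t h
    have hne' : (Prod.fst '' Γ).Nonempty := by
      obtain ⟨s, hs⟩ := hne
      exact ⟨s, _, hΓ0 ⟨s, hs, rfl⟩, rfl⟩
    obtain ⟨_, ⟨⟨v, t⟩, hv, rfl⟩, x, hx, hvx, -⟩ := exists_exit hG hne' hw'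
    -- the neighbours of `v` in the domain do not exhaust the neighbours of its image `t`
    let N := {w | G.Adj v w ∧ w ∈ Prod.fst '' Γ}
    let M := {s | ∃ w ∈ N, (w, s) ∈ Γ}
    have hNfin : N.Finite := (hfin v).subset fun w h => h.1
    have hM : ∃ F : W → V, M = F '' N := by
      have : ∀ w, ∃ s, w ∈ N → (w, s) ∈ Γ := by
        intro w
        by_cases h : w ∈ N
        · obtain ⟨⟨a, s⟩, h', rfl⟩ := h.2
          exact ⟨s, fun _ => h'⟩
        · exact ⟨t, fun h' => absurd h' h⟩
      choose F hF using this
      refine ⟨F, Set.ext fun s => ⟨?_, ?_⟩⟩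
      · rintro ⟨w, hw, hs⟩
        exact ⟨w, hw, hP.func _ _ _ (hF w hw) hs⟩
      · rintro ⟨w, hw, rfl⟩
        exact ⟨w, hw, hF w hw⟩
    obtain ⟨F, hF⟩ := hM
    have hlt : M.ncard < (T.neighborSet t).ncard := by
      have h1 : M.ncard ≤ N.ncard := hF ▸ Set.ncard_image_le hNfin
      have h2 : N.ncard < (G.neighborSet v).ncard :=
        Set.ncard_lt_ncard ⟨fun w h => h.1, fun h => hx (h hvx).2⟩ (hfin v)
      exact h1.trans_lt (h2.trans_le (hle v t))
    obtain ⟨y, hy, hyM⟩ := Set.exists_mem_notMem_of_ncard_lt_ncard hlt (hF ▸ hNfin.image F)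
    have hmax := hΓ.le_of_ge (hP.insert hG hv hx hvx hy
      (fun w hw hvw => hyM ⟨w, ⟨hvw, _, hw, rfl⟩, hw⟩)) (Set.subset_insert _ _)
    exact hx ⟨_, hmax (Set.mem_insert _ _), rfl⟩
  choose F hF using htot
  obtain ⟨E, hE⟩ := exists_embedding_of_locallyInjective hG.connected.preconnected hT
    ⟨F, fun {a b} h => hP.hom _ _ _ _ (hF a) (hF b) h⟩
    (fun w w₁ w₂ h1 h2 e => hP.inj w w₁ w₂ (F w₁) ⟨_, hF w, rfl⟩ (hF w₁)
      (by have e : F w₁ = F w₂ := e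
          rw [e]; exact hF w₂) h1 h2)
  exact ⟨E, fun w hw => (hE w).trans (hP.func _ _ _ (hF w) (hΓ0 ⟨w, hw, rfl⟩))⟩

theorem neighborSet_finite {k : ℕ} (h : ∀ v, valence T v = k + 1) (v : V) :
    (T.neighborSet v).Finite :=
  Set.finite_of_ncard_pos (by have := h v; unfold valence at this; omega)

theorem exists_adj_preimage (F : G ↪g T) {v : W} (hfin : (T.neighborSet (F v)).Finite)
    (h : valence G v = valence T (F v)) {y : V} (hy : T.Adj (F v) y) :
    ∃ x, G.Adj v x ∧ F x = y := by
  have : F '' G.neighborSet v = T.neighborSet (F v) := by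
    refine Set.eq_of_subset_of_ncard_le ?_ ?_ hfin
    · rintro _ ⟨x, hx, rfl⟩
      exact F.map_adj_iff.2 hx
    · rw [Set.ncard_image_of_injective _ F.injective]
      exact h.ge
  obtain ⟨x, hx, e⟩ := this.symm ▸ (show y ∈ T.neighborSet (F v) from hy)
  exact ⟨x, hx, e⟩

/-- An embedding of a regular tree in itself is an automorphism. -/
theorem exists_iso_of_embedding (hT : T.IsTree) {k : ℕ} (h : ∀ v, valence T v = k + 1)
    (F : T ↪g T) : ∃ r : T ≃g T, ∀ v, r v = F v := by
  have surj : Function.Surjective F := by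
    obtain ⟨v⟩ := hT.connected.nonempty
    intro y
    refine preconnected_induction hT.connected.preconnected (P := fun y => ∃ x, F x = y) (F v)
      ⟨v, rfl⟩ ?_ y
    rintro _ w ⟨x, rfl⟩ hw
    obtain ⟨x', -, e⟩ := exists_adj_preimage F (neighborSet_finite h _)
      ((h x).trans (h _).symm) hw
    exact ⟨x', e⟩
  exact ⟨⟨Equiv.ofBijective F ⟨F.injective, surj⟩, F.map_adj_iff⟩, fun _ => rfl⟩

/-- An injective homomorphism from a nonempty convex part of a regular tree to the tree extends to
an automorphism. -/
theorem exists_iso_extending (hT : T.IsTree) {k : ℕ} (h : ∀ v, valence T v = k + 1)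
    {S : Set V} (hS : IsConvex T S) (hne : S.Nonempty) (f : V → V)
    (hom : ∀ u ∈ S, ∀ w ∈ S, T.Adj u w → T.Adj (f u) (f w)) (inj : Set.InjOn f S) :
    ∃ r : T ≃g T, ∀ v ∈ S, r v = f v := by
  obtain ⟨F, hF⟩ := exists_embedding_extending hT hT (neighborSet_finite h)
    (fun w t => ((h w).trans (h t).symm).le) hS hne f hom inj
  obtain ⟨r, hr⟩ := exists_iso_of_embedding hT h F
  exact ⟨r, fun v hv => (hr v).trans (hF v hv)⟩

/-- A map that coincides with an automorphism on the star of each vertex is an automorphism. -/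
theorem exists_iso_of_locally (hT : T.IsTree) {k : ℕ} (h : ∀ v, valence T v = k + 1) (f : V → V)
    (hf : ∀ v, ∃ t : T ≃g T, f v = t v ∧ ∀ x, T.Adj v x → f x = t x) :
    ∃ r : T ≃g T, ∀ v, r v = f v := by
  obtain ⟨F, hF⟩ := exists_embedding_of_locallyInjective hT.connected.preconnected hT
    ⟨f, fun {a b} hab => by
      obtain ⟨t, h1, h2⟩ := hf a
      rw [h1, h2 b hab]
      exact t.map_adj_iff.2 hab⟩
    (fun w w₁ w₂ a₁ a₂ e => by
      obtain ⟨t, -, h2⟩ := hf w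
      change f w₁ = f w₂ at e
      rw [h2 _ a₁, h2 _ a₂] at e
      exact t.injective e)
  obtain ⟨r, hr⟩ := exists_iso_of_embedding hT h F
  exact ⟨r, fun v => (hr v).trans (hF v)⟩

/-- The automorphism group of a regular tree is transitive on oriented edges. -/
theorem exists_iso_edge (hT : T.IsTree) {k : ℕ} (h : ∀ v, valence T v = k + 1) {p q p' q' : V}
    (hpq : T.Adj p q) (hpq' : T.Adj p' q') : ∃ r : T ≃g T, r p = p' ∧ r q = q' := by
  classical
  have hne := hpq.ne
  obtain ⟨r, hr⟩ := exists_iso_extending hT h (IsConvex.pair hpq) ⟨p, by simp⟩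
    (fun v => if v = p then p' else q')
    (by
      rintro u (rfl | rfl) w (rfl | rfl) huw
      · exact absurd rfl huw.ne
      · simpa [hne.symm] using hpq'
      · simpa [hne.symm] using hpq'.symm
      · exact absurd rfl huw.ne)
    (by
      rintro u (rfl | rfl) w (rfl | rfl) e
      · rfl
      · simp only [if_true, hne.symm, if_false] at e
        exact absurd e hpq'.ne
      · simp only [if_true, hne.symm, if_false] at e
        exact absurd e.symm hpq'.ne
      · rfl)
  refine ⟨r, ?_, ?_⟩
  · simpa using hr p (by simp)
  · simpa [hne.symm] using hr q (by simp)

/-- Automorphisms on the branches behind a vertex `c` that send `c` to the same vertex, and the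
neighbours of `c` to distinct vertices, have a common extension. -/
theorem exists_iso_star (hT : T.IsTree) {k : ℕ} (h : ∀ v, valence T v = k + 1) {p c c' : V}
    (hpc : T.Adj p c) (ρ : V → (T ≃g T)) (hc : ∀ y, T.Adj c y → y ≠ p → ρ y c = c')
    (hinj : ∀ y z, T.Adj c y → y ≠ p → T.Adj c z → z ≠ p → ρ y y = ρ z z → y = z) :
    ∃ r : T ≃g T, ∀ y, T.Adj c y → y ≠ p → ∀ z ∈ branch T c y, r z = ρ y z := by
  classical
  let f : V → V := fun z =>
    if hz : ∃ y, T.Adj c y ∧ y ≠ p ∧ z ∈ branch T c y then ρ hz.choose z else c'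
  have hfc : f c = c' := by
    have : ¬ ∃ y, T.Adj c y ∧ y ≠ p ∧ c ∈ branch T c y := by
      rintro ⟨y, h1, -, h2⟩
      exact notMem_branch hT h1 h2
    simp only [f, dif_neg this]
  have hf : ∀ y, T.Adj c y → y ≠ p → ∀ z ∈ branch T c y, f z = ρ y z := by
    intro y hy hyp z hz
    have hex : ∃ y, T.Adj c y ∧ y ≠ p ∧ z ∈ branch T c y := ⟨y, hy, hyp, hz⟩
    have e : hex.choose = y :=
      ((IsConvex.singleton (T := T) c).exit_unique hT rfl (fun h => hex.choose_spec.1.ne h.symm)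
        hex.choose_spec.1 rfl (fun h => hy.ne h.symm) hy hex.choose_spec.2.2 hz).2
    simp only [f, dif_pos hex, e]
  have hadj : ∀ y, T.Adj c y → y ≠ p → T.Adj c' (ρ y y) := fun y hy hyp => by
    rw [← hc y hy hyp]; exact (ρ y).map_adj_iff.2 hy
  have hmem : ∀ y, T.Adj c y → y ≠ p → ∀ z ∈ branch T c y, f z ∈ branch T c' (ρ y y) := by
    intro y hy hyp z hz
    rw [hf y hy hyp z hz, ← hc y hy hyp]
    exact mem_branch_map _ hz
  have adj1 : ∀ y w, T.Adj c y → y ≠ p → w ∈ branch T c y → T.Adj c w → T.Adj c' (f w) := by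
    intro y w hy hyp hw hcw
    obtain ⟨rfl, -⟩ := branch_exit hT hy hw (notMem_branch hT hy) hcw.symm
    rw [hf w hy hyp w hw]
    exact hadj w hy hyp
  obtain ⟨r, hr⟩ := exists_iso_extending hT h (isConvex_branch hT hpc) ⟨c, mem_branch_self _ _⟩ f
    (by
      intro u hu w hw huw
      rcases exists_mem_branch_of_mem hT hpc hu with rfl | ⟨y, hy, hyp, huy⟩
      · rcases exists_mem_branch_of_mem hT hpc hw with rfl | ⟨z, hz, hzp, hwz⟩
        · exact absurd rfl huw.ne
        · rw [hfc]; exact adj1 z w hz hzp hwz huw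
      · by_cases hwy : w ∈ branch T c y
        · rw [hf y hy hyp u huy, hf y hy hyp w hwy]
          exact (ρ y).map_adj_iff.2 huw
        · obtain ⟨-, rfl⟩ := branch_exit hT hy huy hwy huw
          rw [hfc]; exact (adj1 y u hy hyp huy huw.symm).symm)
    (by
      have nc : ∀ y z, T.Adj c y → y ≠ p → z ∈ branch T c y → f z ≠ c' :=
        fun y z hy hyp hz e => notMem_branch hT (hadj y hy hyp) (e ▸ hmem y hy hyp z hz)
      intro u hu w hw e
      rcases exists_mem_branch_of_mem hT hpc hu with rfl | ⟨y, hy, hyp, huy⟩ <;>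
        rcases exists_mem_branch_of_mem hT hpc hw with rfl | ⟨z, hz, hzp, hwz⟩
      · rfl
      · exact absurd (e.symm.trans hfc) (nc z w hz hzp hwz)
      · exact absurd (e.trans hfc) (nc y u hy hyp huy)
      · have h1 := hmem y hy hyp u huy
        rw [e] at h1
        have h2 := ((IsConvex.singleton (T := T) c').exit_unique hT rfl
          (fun h => (hadj y hy hyp).ne h.symm) (hadj y hy hyp) rfl
          (fun h => (hadj z hz hzp).ne h.symm) (hadj z hz hzp) h1 (hmem z hz hzp w hwz)).2
        obtain rfl := hinj y z hy hyp hz hzp h2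
        rw [hf y hy hyp u huy, hf y hy hyp w hwz] at e
        exact (ρ y).injective e)
  refine ⟨r, fun y hy hyp z hz => ?_⟩
  rw [hr z (branch_nested hT hpc hy hyp hz), hf y hy hyp z hz]

end Extension

/-! ### Ways and balls -/

section Ball

variable {V : Type*} {T : SimpleGraph V} {n : ℕ}

theorem valence_of_regular [T.LocallyFinite] (hreg : T.IsRegularOfDegree (n + 1)) (v : V) :
    valence T v = n + 1 := by
  rw [← hreg v, valence, Set.ncard_eq_toFinset_card', SimpleGraph.degree,
    SimpleGraph.neighborFinset]

theorem exists_adj_ne_ne (hn : 2 ≤ n) (hval : ∀ v, valence T v = n + 1) (v a b : V) :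
    ∃ r, T.Adj v r ∧ r ≠ a ∧ r ≠ b := by
  have h : ({a, b} : Set V).ncard < (T.neighborSet v).ncard := by
    have h1 := hval v
    have h2 := Set.ncard_insert_le a {b}
    rw [Set.ncard_singleton] at h2
    unfold valence at h1
    omega
  obtain ⟨r, hr, hr'⟩ := Set.exists_mem_notMem_of_ncard_lt_ncard h
  simp only [Set.mem_insert_iff, Set.mem_singleton_iff, not_or] at hr'
  exact ⟨r, hr, hr'⟩

/-- A relation along oriented edges that can always be continued without backtracking holds along
a way. -/
theorem exists_way (P : V → V → Prop) (hP : ∀ a b, P a b → T.Adj a b)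
    (step : ∀ a b, P a b → ∃ c, c ≠ a ∧ P b c) {p q : V} (h : P p q) :
    ∃ a : Way T, a.1 0 = p ∧ a.1 1 = q ∧ ∀ i, P (a.1 i) (a.1 (i + 1)) := by
  have : ∀ e : {e : V × V // P e.1 e.2}, ∃ c, c ≠ e.1.1 ∧ P e.1.2 c := fun e => step _ _ e.2
  choose nx h1 h2 using this
  let s : ℕ → {e : V × V // P e.1 e.2} := fun i =>
    Nat.rec ⟨(p, q), h⟩ (fun _ e => ⟨(e.1.2, nx e), h2 e⟩) i
  exact ⟨⟨fun i => (s i).1.1, fun i => hP _ _ (s i).2, fun i => h1 (s i)⟩, rfl, rfl,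
    fun i => (s i).2⟩

theorem way_mem_branch (hT : T.IsTree) (a : Way T) (i k : ℕ) :
    a.1 (i + 1 + k) ∈ branch T (a.1 i) (a.1 (i + 1)) := by
  induction k generalizing i with
  | zero => exact mem_branch_self _ _
  | succ k ih =>
    have h := ih (i + 1)
    rw [show i + 1 + 1 + k = i + 1 + (k + 1) by omega] at h
    exact branch_nested hT (a.2.1 i) (a.2.1 (i + 1)) (a.2.2 i) h

theorem way_branch_antitone (hT : T.IsTree) (a : Way T) {i j : ℕ} (hij : i ≤ j) :
    branch T (a.1 j) (a.1 (j + 1)) ⊆ branch T (a.1 i) (a.1 (i + 1)) := by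
  induction j, hij using Nat.le_induction with
  | base => exact subset_rfl
  | succ j _ ih => exact (branch_nested hT (a.2.1 j) (a.2.1 (j + 1)) (a.2.2 j)).trans ih

theorem way_injective (hT : T.IsTree) (a : Way T) : Function.Injective a.1 := by
  have key : ∀ i j, i < j → a.1 i ≠ a.1 j := by
    intro i j hij e
    obtain ⟨k, rfl⟩ := Nat.exists_eq_add_of_lt hij
    have h := way_mem_branch hT a i k
    rw [show i + 1 + k = i + k + 1 by omega, ← e] at h
    exact notMem_branch hT (a.2.1 i) h
  intro i j e
  rcases lt_trichotomy i j with h | h | h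
  · exact absurd e (key i j h)
  · exact h
  · exact absurd e.symm (key j i h)

/-- A way eventually turns away from each vertex. -/
theorem way_eventually_notMem (hT : T.IsTree) (a : Way T) (p : V) :
    ∃ k, ∀ i, k ≤ i → p ∉ branch T (a.1 i) (a.1 (i + 1)) := by
  suffices ∃ k, p ∉ branch T (a.1 k) (a.1 (k + 1)) from
    this.imp fun k hk i hi h => hk (way_branch_antitone hT a hi h)
  refine preconnected_induction hT.connected.preconnected
    (P := fun p => ∃ k, p ∉ branch T (a.1 k) (a.1 (k + 1))) (a.1 0)
    ⟨0, notMem_branch hT (a.2.1 0)⟩ ?_ p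
  rintro v w ⟨k, hk⟩ hvw
  by_cases hw : w ∈ branch T (a.1 k) (a.1 (k + 1))
  · refine ⟨k + 1, ?_⟩
    rw [(branch_exit hT (a.2.1 k) hw hk hvw.symm).1]
    exact notMem_branch hT (a.2.1 (k + 1))
  · exact ⟨k, hw⟩

/-- The way with the first `k` vertices dropped. -/
def Way.shift (a : Way T) (k : ℕ) : Way T :=
  ⟨fun i => a.1 (i + k), fun i => by have := a.2.1 (i + k); rwa [add_right_comm] at this,
    fun i => by have := a.2.2 (i + k); rwa [add_right_comm] at this⟩

theorem Bdry.mk_shift (a : Way T) (k : ℕ) : Bdry.mk (a.shift k) = Bdry.mk a :=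
  Quotient.sound ⟨0, k, fun _ => rfl⟩

theorem mk_mem_ball_iff (a : Way T) (p q : V) :
    Bdry.mk a ∈ ball T p q ↔ ∃ k, ∀ i, k ≤ i → a.1 i ∈ branch T p q := by
  constructor
  · rintro ⟨b, hb, e⟩
    obtain ⟨k, l, h⟩ : wayEquiv T b a := Quotient.exact e
    refine ⟨l, fun i hi => ?_⟩
    obtain ⟨j, rfl⟩ := Nat.exists_eq_add_of_le' hi
    rw [← h j]
    exact hb _
  · rintro ⟨k, hk⟩
    exact ⟨a.shift k, fun i => hk _ (Nat.le_add_left _ _), Bdry.mk_shift a k⟩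

theorem mk_mem_ball (hT : T.IsTree) (a : Way T) (i : ℕ) :
    Bdry.mk a ∈ ball T (a.1 i) (a.1 (i + 1)) := by
  refine (mk_mem_ball_iff a _ _).2 ⟨i + 1, fun j hj => ?_⟩
  obtain ⟨k, rfl⟩ := Nat.exists_eq_add_of_le hj
  exact way_mem_branch hT a i k

theorem ball_mono {p q p' q' : V} (h : branch T p q ⊆ branch T p' q') :
    ball T p q ⊆ ball T p' q' := by
  rintro _ ⟨a, ha, rfl⟩
  exact ⟨a, fun i => h (ha i), rfl⟩

theorem notMem_ball_iff (hT : T.IsTree) {p q : V} (h : T.Adj p q) {x : Bdry T} :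
    x ∉ ball T p q ↔ x ∈ ball T q p := by
  induction x using Quotient.inductionOn with
  | h a =>
  change Bdry.mk a ∉ ball T p q ↔ Bdry.mk a ∈ ball T q p
  constructor
  · intro hx
    have hx' := hx
    rw [mk_mem_ball_iff] at hx ⊢
    push Not at hx
    obtain ⟨i, -, hi⟩ := hx 0
    refine ⟨i, fun j hj => ?_⟩
    induction j, hj using Nat.le_induction with
    | base => exact mem_branch_symm hT hi
    | succ j _ ih =>
      by_contra hj
      obtain ⟨e1, e2⟩ := branch_exit hT h.symm ih hj (a.2.1 j)
      exact hx' (e1 ▸ e2 ▸ mk_mem_ball hT a j)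
  · intro h1 h2
    obtain ⟨k, hk⟩ := (mk_mem_ball_iff a _ _).1 h1
    obtain ⟨l, hl⟩ := (mk_mem_ball_iff a _ _).1 h2
    exact (notMem_branch_iff hT h).2 (hk _ (le_max_left k l)) (hl _ (le_max_right k l))

theorem ball_nonempty (hT : T.IsTree) (hn : 2 ≤ n) (hval : ∀ v, valence T v = n + 1) {p q : V}
    (h : T.Adj p q) : (ball T p q).Nonempty := by
  obtain ⟨a, rfl, rfl, -⟩ := exists_way (T := T) T.Adj (fun _ _ h => h) (fun a b _ => by
    obtain ⟨r, h1, h2, -⟩ := exists_adj_ne_ne hn hval b a a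
    exact ⟨r, h2, h1⟩) h
  exact ⟨_, mk_mem_ball hT a 0⟩

/-- The branch is determined by its ball, as the tree ramifies at each vertex. -/
theorem ball_subset_iff (hT : T.IsTree) (hn : 2 ≤ n) (hval : ∀ v, valence T v = n + 1)
    {p q p' q' : V} (h : T.Adj p q) (h' : T.Adj p' q') :
    ball T p q ⊆ ball T p' q' ↔ branch T p q ⊆ branch T p' q' := by
  refine ⟨fun hb v hv => ?_, ball_mono⟩
  by_contra hv'
  have hv'' := mem_branch_symm hT hv'
  -- a branch at `v` that leads neither to `p` nor to `q'`
  obtain ⟨a, ha, hpa⟩ := exists_adj_branch hT (p := p) (y := v)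
    (fun e => notMem_branch hT h (e ▸ hv))
  obtain ⟨b, hb', hqb⟩ := exists_adj_branch hT (p := q') (y := v)
    (fun e => notMem_branch hT h'.symm (e ▸ hv''))
  obtain ⟨r, hr, hra, hrb⟩ := exists_adj_ne_ne hn hval v a b
  have avoid : ∀ {z c}, T.Adj v c → z ∈ branch T v c → r ≠ c → z ∉ branch T v r := by
    intro z c hc hz hrc hz'
    exact hrc ((IsConvex.singleton (T := T) v).exit_unique hT rfl (fun e => hr.ne e.symm) hr rfl
      (fun e => hc.ne e.symm) hc hz' hz).2
  have sub : ∀ {z w}, T.Adj z w → v ∈ branch T z w → z ∉ branch T v r →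
      branch T v r ⊆ branch T z w := by
    intro z w hzw hvzw hz
    refine branch_subset hT hzw hz (mem_branch_self v r) ?_
    by_contra hr'
    exact hz ((branch_exit hT hzw hvzw hr' hr).2 ▸ mem_branch_self _ _)
  obtain ⟨x, hx⟩ := ball_nonempty hT hn hval hr
  exact (notMem_ball_iff hT h').2 (ball_mono (sub h'.symm hv'' (avoid hb' hqb hrb)) hx)
    (hb (ball_mono (sub h hv (avoid ha hpa hra)) hx))

theorem ball_inj (hT : T.IsTree) (hn : 2 ≤ n) (hval : ∀ v, valence T v = n + 1)
    {p q p' q' : V} (h : T.Adj p q) (h' : T.Adj p' q') (e : ball T p q = ball T p' q') :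
    p = p' ∧ q = q' :=
  branch_inj hT h h' (Set.Subset.antisymm ((ball_subset_iff hT hn hval h h').1 e.subset)
    ((ball_subset_iff hT hn hval h' h).1 e.superset))

theorem isOpen_ball {p q : V} (h : T.Adj p q) : IsOpen (ball T p q) :=
  TopologicalSpace.isOpen_generateFrom_of_mem ⟨p, q, h, rfl⟩

/-- The balls of the branches that a way enters form a basis of neighbourhoods of its end. -/
theorem exists_ball_subset (hT : T.IsTree) (a : Way T) {U : Set (Bdry T)} (hU : IsOpen U)
    (ha : Bdry.mk a ∈ U) : ∃ k, ∀ i, k ≤ i → ball T (a.1 i) (a.1 (i + 1)) ⊆ U := by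
  have hU' : TopologicalSpace.GenerateOpen {B | ∃ p q, T.Adj p q ∧ B = ball T p q} U := hU
  clear hU
  induction hU' with
  | basic U h =>
    obtain ⟨p, q, hpq, rfl⟩ := h
    obtain ⟨k, hk⟩ := (mk_mem_ball_iff a p q).1 ha
    obtain ⟨l, hl⟩ := way_eventually_notMem hT a p
    refine ⟨max k l, fun i hi => ball_mono (branch_subset hT hpq (hl i (le_of_max_le_right hi))
      (mem_branch_self _ _) (hk (i + 1) ?_))⟩
    exact (le_of_max_le_left hi).trans (Nat.le_succ i)
  | univ => exact ⟨0, fun _ _ => Set.subset_univ _⟩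
  | inter U U' _ _ ih ih' =>
    obtain ⟨k, hk⟩ := ih ha.1
    obtain ⟨l, hl⟩ := ih' ha.2
    exact ⟨max k l, fun i hi => Set.subset_inter (hk i (le_of_max_le_left hi))
      (hl i (le_of_max_le_right hi))⟩
  | sUnion c _ ih =>
    obtain ⟨U, hU, haU⟩ := ha
    obtain ⟨k, hk⟩ := ih U hU haU
    exact ⟨k, fun i hi => (hk i hi).trans (Set.subset_sUnion_of_mem hU)⟩

theorem image_ball (r : T ≃g T) (p q : V) : bdryMap r '' ball T p q = ball T (r p) (r q) := by
  refine Set.Subset.antisymm ?_ fun x hx => ⟨bdryMap r⁻¹ x, ?_, ?_⟩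
  · rintro _ ⟨x, hx, rfl⟩
    exact bdryMap_mem_ball r hx
  · have := bdryMap_mem_ball r⁻¹ hx
    rwa [RelIso.inv_apply_self, RelIso.inv_apply_self] at this
  · rw [← bdryMap_mul, mul_inv_cancel, bdryMap_one]

theorem bdryMap_congr {r r' : T ≃g T} {p q : V} (h : ∀ v ∈ branch T p q, r v = r' v)
    {x : Bdry T} (hx : x ∈ ball T p q) : bdryMap r x = bdryMap r' x := by
  obtain ⟨a, ha, rfl⟩ := hx
  exact congrArg Bdry.mk (Subtype.ext (funext fun i => h _ (ha i)))

end Ball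

/-! ### Regarded balls -/

section Regarded

variable {V : Type*} {T : SimpleGraph V} {n : ℕ}

/-- On the ball of the branch at `pq`, the map `g` of the boundary coincides with an automorphism of
the tree. For homeomorphisms `g` and a regular tree this says that `g` regards this ball. -/
def AgreesOn (g : Bdry T → Bdry T) (p q : V) : Prop :=
  ∃ r : T ≃g T, ∀ x ∈ ball T p q, g x = bdryMap r x

theorem AgreesOn.mono {g : Bdry T → Bdry T} {p q p' q' : V} (h : AgreesOn g p q)
    (hb : branch T p' q' ⊆ branch T p q) : AgreesOn g p' q' :=
  h.imp fun _ hr x hx => hr x (ball_mono hb hx)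

theorem image_ball_of_eqOn {g : Bdry T → Bdry T} {r : T ≃g T} {p q : V}
    (h : ∀ x ∈ ball T p q, g x = bdryMap r x) : g '' ball T p q = ball T (r p) (r q) := by
  rw [← image_ball]
  exact Set.image_congr h

/-- The restriction of an automorphism to a branch. -/
def branchIso (r : T ≃g T) (p q : V) :
    T.induce (branch T p q) ≃g T.induce (branch T (r p) (r q)) where
  toFun v := ⟨r v.1, mem_branch_map r v.2⟩
  invFun v := ⟨r⁻¹ v.1, by
    have := mem_branch_map r⁻¹ v.2
    rwa [RelIso.inv_apply_self, RelIso.inv_apply_self] at this⟩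
  left_inv v := Subtype.ext (r.symm_apply_apply v.1)
  right_inv v := Subtype.ext (r.apply_symm_apply v.1)
  map_rel_iff' := r.map_adj_iff

theorem regards_iff (hT : T.IsTree) (hval : ∀ v, valence T v = n + 1) (g : Bdry T ≃ₜ Bdry T)
    (B : Set (Bdry T)) :
    Regards T g B ↔ ∃ p q, T.Adj p q ∧ B = ball T p q ∧ AgreesOn g p q := by
  constructor
  · rintro ⟨p, q, p', q', h, h', rfl, -, φ, hφ⟩
    classical
    refine ⟨p, q, h, rfl, ?_⟩
    let f : V → V := fun v => if hv : v ∈ branch T p q then φ ⟨v, hv⟩ else v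
    have hf : ∀ v (hv : v ∈ branch T p q), f v = φ ⟨v, hv⟩ := fun v hv => dif_pos hv
    obtain ⟨r, hr⟩ := exists_iso_extending hT hval (isConvex_branch hT h)
      ⟨q, mem_branch_self _ _⟩ f
      (fun u hu w hw huw => by
        rw [hf u hu, hf w hw]
        exact φ.map_adj_iff.2 (show (T.induce _).Adj ⟨u, hu⟩ ⟨w, hw⟩ from huw))
      (fun u hu w hw e => by
        rw [hf u hu, hf w hw] at e
        exact congrArg Subtype.val (φ.injective (Subtype.ext e)))
    refine ⟨r, ?_⟩
    rintro _ ⟨a, ha, rfl⟩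
    exact hφ a (a.map r) fun i => ⟨ha i, (hr _ (ha i)).trans (hf _ (ha i))⟩
  · rintro ⟨p, q, h, rfl, r, hr⟩
    refine ⟨p, q, r p, r q, h, r.map_adj_iff.2 h, rfl, image_ball_of_eqOn hr, branchIso r p q, ?_⟩
    intro a b hab
    rw [hr _ ⟨a, fun i => (hab i).1, rfl⟩]
    refine congrArg Bdry.mk (Subtype.ext (funext fun i => ?_))
    obtain ⟨_, e⟩ := hab i
    exact e.symm

/-- `g` is induced by an automorphism of the tree. -/
def IsAut (g : Bdry T → Bdry T) : Prop := ∃ r : T ≃g T, ∀ x, g x = bdryMap r x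

/-- If both halves of an edge are regarded, then the two automorphisms agree on this edge and can be
glued. -/
theorem isAut_of_agreesOn (hT : T.IsTree) (hn : 2 ≤ n) (hval : ∀ v, valence T v = n + 1)
    (g : Bdry T ≃ₜ Bdry T) {p q : V} (hpq : T.Adj p q) (h : AgreesOn g p q)
    (h' : AgreesOn g q p) : IsAut g := by
  classical
  obtain ⟨r, hr⟩ := h
  obtain ⟨r', hr'⟩ := h'
  have e1 := image_ball_of_eqOn hr
  have e2 := image_ball_of_eqOn hr'
  have hc : ball T q p = (ball T p q)ᶜ := Set.ext fun x => (notMem_ball_iff hT hpq).symm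
  have e3 : ball T (r q) (r p) = ball T (r' q) (r' p) := by
    rw [← e2, hc, Set.image_compl_eq g.bijective, e1]
    exact Set.ext fun x => (notMem_ball_iff hT (r.map_adj_iff.2 hpq)).symm
  obtain ⟨hq, hp⟩ := ball_inj hT hn hval (r.map_adj_iff.2 hpq.symm) (r'.map_adj_iff.2 hpq.symm) e3
  let f : V → V := fun v => if v ∈ branch T p q then r v else r' v
  have f1 : ∀ v ∈ branch T p q, f v = r v := fun v hv => if_pos hv
  have f2 : ∀ v ∉ branch T p q, f v = r' v := fun v hv => if_neg hv
  obtain ⟨t, ht⟩ := exists_iso_of_locally hT hval f (fun v => by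
    by_cases hv : v ∈ branch T p q
    · refine ⟨r, f1 v hv, fun x hx => ?_⟩
      by_cases hxb : x ∈ branch T p q
      · exact f1 x hxb
      · rw [f2 x hxb, (branch_exit hT hpq hv hxb hx).2, hp]
    · refine ⟨r', f2 v hv, fun x hx => ?_⟩
      by_cases hxb : x ∈ branch T p q
      · rw [f1 x hxb, (branch_exit hT hpq hxb hv hx.symm).1, hq]
      · exact f2 x hxb)
  refine ⟨t, fun x => ?_⟩
  by_cases hx : x ∈ ball T p q
  · rw [hr x hx]
    exact bdryMap_congr (fun v hv => ((ht v).trans (f1 v hv)).symm) hx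
  · rw [notMem_ball_iff hT hpq] at hx
    rw [hr' x hx]
    exact bdryMap_congr
      (fun v hv => ((ht v).trans (f2 v ((notMem_branch_iff hT hpq).2 hv))).symm) hx

theorem agreesOn_of_isAut {g : Bdry T → Bdry T} (h : IsAut g) (p q : V) : AgreesOn g p q :=
  h.imp fun _ hr x _ => hr x

/-- Along each way, a spheromorphism eventually coincides with an automorphism. -/
theorem exists_agreesOn_way (hT : T.IsTree) {g : Bdry T ≃ₜ Bdry T} (hg : g ∈ Hier T)
    (a : Way T) : ∃ k, AgreesOn g (a.1 k) (a.1 (k + 1)) := by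
  obtain ⟨N, hN, r, hr⟩ := hg (Bdry.mk a)
  obtain ⟨U, hUN, hU, ha⟩ := mem_nhds_iff.1 hN
  obtain ⟨k, hk⟩ := exists_ball_subset hT a hU ha
  exact ⟨k, r, fun x hx => hr x (hUN (hk k le_rfl hx))⟩

theorem mem_hier_of_agreesOn {g : Bdry T ≃ₜ Bdry T}
    (h : ∀ x, ∃ p q, T.Adj p q ∧ x ∈ ball T p q ∧ AgreesOn g p q) : g ∈ Hier T := by
  intro x
  obtain ⟨p, q, hpq, hx, r, hr⟩ := h x
  exact ⟨_, (isOpen_ball hpq).mem_nhds hx, r, hr⟩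

/-- The vertices that are not the root of a branch whose ball is regarded by `g`. For a
spheromorphism that is not an automorphism, they span the skeleton of the thorn of `g`. -/
def core (g : Bdry T → Bdry T) : Set V := {v | ∀ p, T.Adj p v → ¬ AgreesOn g p v}

theorem notMem_core_of_mem_branch (hT : T.IsTree) {g : Bdry T → Bdry T} {p q v : V}
    (hpq : T.Adj p q) (h : AgreesOn g p q) (hv : v ∈ branch T p q) : v ∉ core g := by
  obtain ⟨v', hv', hb⟩ := exists_subbranch hT hpq hv
  exact fun hc => hc v' hv' (h.mono hb)

theorem agreesOn_exit_core (hT : T.IsTree) {g : Bdry T → Bdry T} {v x : V} (hv : v ∈ core g)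
    (hx : x ∉ core g) (h : T.Adj v x) : AgreesOn g v x := by
  have hx' : ¬ ∀ p, T.Adj p x → ¬ AgreesOn g p x := hx
  push Not at hx'
  obtain ⟨p, hp, hpx⟩ := hx'
  by_cases e : p = v
  · rwa [e] at hpx
  · exact absurd hv (notMem_core_of_mem_branch hT hp hpx (branch_nested hT hp h.symm
      (fun e' => e e'.symm) (mem_branch_self _ _)))

theorem isConvex_core (hT : T.IsTree) (g : Bdry T → Bdry T) : IsConvex T (core g) := by
  intro v hv x hx h y hy
  refine mem_branch_symm hT fun hy' => ?_
  exact notMem_core_of_mem_branch hT h (agreesOn_exit_core hT hv hx h) hy' hy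

/-- If the core were empty, one could go backwards forever through regarded branches. -/
theorem core_nonempty (hT : T.IsTree) (hn : 2 ≤ n) (hval : ∀ v, valence T v = n + 1)
    {g : Bdry T ≃ₜ Bdry T} (hg : g ∈ Hier T) (hng : ¬ IsAut g) : (core g).Nonempty := by
  by_contra hne
  have hex : ∀ v, ∃ p, T.Adj p v ∧ AgreesOn g p v := by
    intro v
    by_contra h
    push Not at h
    exact hne ⟨v, fun p hp => h p hp⟩
  -- near the end of the backward way, the complement of one of the regarded balls is regarded, too
  obtain ⟨v⟩ := hT.connected.nonempty
  obtain ⟨p, hp, hpv⟩ := hex v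
  obtain ⟨a, -, -, ha⟩ := exists_way (T := T) (fun a b => T.Adj b a ∧ AgreesOn g b a)
    (fun a b h => h.1.symm)
    (fun a b h => by
      obtain ⟨c, hc, hcb⟩ := hex b
      refine ⟨c, ?_, hc, hcb⟩
      rintro rfl
      exact hng (isAut_of_agreesOn hT hn hval g hc hcb h.2))
    (p := v) (q := p) ⟨hp, hpv⟩
  obtain ⟨k, hk⟩ := exists_agreesOn_way hT hg a
  exact hng (isAut_of_agreesOn hT hn hval g (a.2.1 k) hk (ha k).2)

/-- If the core were infinite, König's argument would give a way that always has infinitely many of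
its vertices ahead, although the balls along this way are eventually regarded. -/
theorem core_finite (hT : T.IsTree) (hval : ∀ v, valence T v = n + 1)
    {g : Bdry T ≃ₜ Bdry T} (hg : g ∈ Hier T) : (core g).Finite := by
  by_contra hinf
  let P : V → V → Prop := fun a b => T.Adj a b ∧ (core g ∩ branch T a b).Infinite
  have next : ∀ b (A : Set V), A.Infinite →
      (∀ y ∈ A, y = b ∨ ∃ x, T.Adj b x ∧ y ∈ branch T b x) →
      ∃ x, T.Adj b x ∧ (A ∩ branch T b x).Infinite := by
    intro b A hA hAb
    by_contra hcon
    push Not at hcon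
    have hfin : (⋃ x ∈ T.neighborSet b, A ∩ branch T b x).Finite :=
      (neighborSet_finite hval b).biUnion fun x hx => hcon x hx
    refine hA ((hfin.insert b).subset fun y hy => ?_)
    rcases hAb y hy with rfl | ⟨x, hx, hyx⟩
    · exact Set.mem_insert _ _
    · exact Set.mem_insert_of_mem _ (Set.mem_biUnion (x := x) hx ⟨hy, hyx⟩)
  have cover : ∀ b y, y = b ∨ ∃ x, T.Adj b x ∧ y ∈ branch T b x := by
    intro b y
    by_cases h : y = b
    · exact Or.inl h
    · exact Or.inr (exists_adj_branch hT h)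
  obtain ⟨v⟩ := hT.connected.nonempty
  obtain ⟨x, hx⟩ : ∃ x, P v x := next v (core g) hinf fun y _ => cover v y
  obtain ⟨a, -, -, ha⟩ := exists_way (T := T) P (fun a b h => h.1) (fun a b h => by
    obtain ⟨c, hc, hinf'⟩ := next b _ h.2 fun y _ => cover b y
    refine ⟨c, ?_, hc, hinf'.mono fun y hy => ⟨hy.1.1, hy.2⟩⟩
    rintro rfl
    refine hinf' (Set.finite_empty.subset ?_)
    rintro y ⟨⟨-, h1⟩, h2⟩
    exact (notMem_branch_iff hT h.1).2 h2 h1) hx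
  obtain ⟨k, hk⟩ := exists_agreesOn_way hT hg a
  refine (ha k).2 (Set.finite_empty.subset ?_)
  rintro y ⟨h1, h2⟩
  exact notMem_core_of_mem_branch hT (a.2.1 k) hk h2 h1

/-- If `g` is not an automorphism, its maximal regarded balls are those of the edges that leave its
core. -/
theorem maximal_regards_iff (hT : T.IsTree) (hn : 2 ≤ n) (hval : ∀ v, valence T v = n + 1)
    {g : Bdry T ≃ₜ Bdry T} (hng : ¬ IsAut g) (B : Set (Bdry T)) :
    Maximal (Regards T g) B ↔
      ∃ v ∈ core g, ∃ x ∉ core g, T.Adj v x ∧ B = ball T v x := by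
  constructor
  · intro hB
    obtain ⟨p, q, hpq, rfl, h⟩ := (regards_iff hT hval g B).1 hB.prop
    refine ⟨p, ?_, q, fun hq => hq p hpq h, hpq, rfl⟩
    intro p' hp' h'
    have hne : p' ≠ q := by
      rintro rfl
      exact hng (isAut_of_agreesOn hT hn hval g hpq h h')
    have h1 := hB.le_of_ge ((regards_iff hT hval g _).2 ⟨p', p, hp', rfl, h'⟩)
      (ball_mono (branch_nested hT hp' hpq hne.symm))
    exact notMem_branch hT hpq ((ball_subset_iff hT hn hval hp' hpq).1 h1 (mem_branch_self _ _))
  · rintro ⟨v, hv, x, hx, h, rfl⟩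
    refine ⟨(regards_iff hT hval g _).2 ⟨v, x, h, rfl, agreesOn_exit_core hT hv hx h⟩, ?_⟩
    intro B' hB' hle
    obtain ⟨p, q, hpq, rfl, h'⟩ := (regards_iff hT hval g B').1 hB'
    refine ball_mono ?_
    have hvb : v ∉ branch T p q := fun h1 => notMem_core_of_mem_branch hT hpq h' h1 hv
    exact branch_subset hT h hvb
      ((ball_subset_iff hT hn hval h hpq).1 hle (mem_branch_self _ _)) (mem_branch_self _ _)

theorem not_maximal_of_isAut (hT : T.IsTree) (hn : 2 ≤ n) (hval : ∀ v, valence T v = n + 1)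
    {g : Bdry T ≃ₜ Bdry T} (hg : IsAut g) (B : Set (Bdry T)) : ¬ Maximal (Regards T g) B := by
  intro hB
  obtain ⟨p, q, hpq, rfl, -⟩ := (regards_iff hT hval g B).1 hB.prop
  obtain ⟨p', hp', hne, -⟩ := exists_adj_ne_ne hn hval p q q
  have h1 := hB.le_of_ge
    ((regards_iff hT hval g _).2 ⟨p', p, hp'.symm, rfl, agreesOn_of_isAut hg _ _⟩)
    (ball_mono (branch_nested hT hp'.symm hpq hne.symm))
  exact notMem_branch hT hpq
    ((ball_subset_iff hT hn hval hp'.symm hpq).1 h1 (mem_branch_self _ _))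

/-- Since a way leaves each finite set for good, the edges that leave a finite nonempty set of
vertices determine balls that cover the boundary. -/
theorem exists_exit_ball (hT : T.IsTree) {S : Set V} (hS : S.Finite) (hne : S.Nonempty)
    (x : Bdry T) : ∃ v ∈ S, ∃ y ∉ S, T.Adj v y ∧ x ∈ ball T v y := by
  induction x using Quotient.inductionOn with
  | h a =>
  obtain ⟨k, hk⟩ : ∃ k, ∀ i, k ≤ i → a.1 i ∉ S := by
    obtain ⟨m, hm⟩ := (hS.preimage (way_injective hT a).injOn).bddAbove
    exact ⟨m + 1, fun i hi h => absurd (hm h) (by omega)⟩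
  obtain ⟨v, hv, y, hy, hvy, hb⟩ := exists_exit hT hne (hk k le_rfl)
  refine ⟨v, hv, y, hy, hvy, (mk_mem_ball_iff a v y).2 ⟨k, fun i hi => ?_⟩⟩
  induction i, hi using Nat.le_induction with
  | base => exact hb
  | succ i hi ih =>
    by_contra h
    exact hk (i + 1) (hi.trans (Nat.le_succ i)) ((branch_exit hT hvy ih h (a.2.1 i)).2 ▸ hv)

/-- A finite set of vertices that meets a branch contains a vertex of this branch behind which it
does not extend. -/
theorem exists_terminal (hT : T.IsTree) {S : Set V} (hS : S.Finite) {p q : V} (hpq : T.Adj p q)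
    (hne : (S ∩ branch T p q).Nonempty) :
    ∃ c ∈ S, ∃ p', T.Adj p' c ∧ branch T p' c ⊆ branch T p q ∧
      ∀ y, T.Adj c y → y ≠ p' → y ∉ S := by
  have : ∀ m : ℕ, ∀ p' c, T.Adj p' c → branch T p' c ⊆ branch T p q → c ∈ S →
      (S ∩ branch T p' c).ncard ≤ m → ∃ c ∈ S, ∃ p', T.Adj p' c ∧
        branch T p' c ⊆ branch T p q ∧ ∀ y, T.Adj c y → y ≠ p' → y ∉ S := by
    intro m
    induction m with
    | zero =>
      intro p' c _ _ hc hm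
      have h0 := (Set.ncard_eq_zero (hS.inter_of_left _)).1 (Nat.le_zero.1 hm)
      exact absurd (h0 ▸ (⟨hc, mem_branch_self p' c⟩ : c ∈ S ∩ branch T p' c))
        (Set.notMem_empty c)
    | succ m ih =>
      intro p' c hadj hb hc hm
      by_cases h : ∀ y, T.Adj c y → y ≠ p' → y ∉ S
      · exact ⟨c, hc, p', hadj, hb, h⟩
      · push Not at h
        obtain ⟨y, hy, hyp, hyS⟩ := h
        have hsub := branch_nested hT hadj hy hyp
        refine ih c y hy (hsub.trans hb) hyS (Nat.le_of_lt_succ (lt_of_lt_of_le ?_ hm))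
        refine Set.ncard_lt_ncard ⟨fun z hz => ⟨hz.1, hsub hz.2⟩, fun h => ?_⟩
          (hS.inter_of_left _)
        exact notMem_branch hT hy (h ⟨hc, mem_branch_self _ _⟩).2
  obtain ⟨c, hcS, hc⟩ := hne
  obtain ⟨p', h1, h2⟩ := exists_subbranch hT hpq hc
  exact this _ p' c h1 h2 hcS le_rfl

end Regarded

/-! ### Thorns embedded in the tree -/

section ThornBasics

variable {n : ℕ} {R : Thorn n}

instance (R : Thorn n) : Finite R.carrier := R.finite

instance (R : Thorn n) : Finite R.Spike := inferInstanceAs (Finite (Subtype _))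

instance (R : Thorn n) : Finite R.Vert := inferInstanceAs (Finite (Subtype _))

theorem Thorn.isTree [Nonempty R.carrier] : R.graph.IsTree :=
  (R.isThorn.resolve_left (not_isEmpty_of_nonempty _)).1

theorem Thorn.three_le_card [Nonempty R.carrier] : 3 ≤ Nat.card R.carrier :=
  (R.isThorn.resolve_left (not_isEmpty_of_nonempty _)).2.1

theorem Thorn.valence_le (c : R.carrier) : valence R.graph c ≤ n + 1 :=
  (R.isThorn.resolve_left (not_isEmpty_of_nonempty (h := ⟨c⟩))).2.2 c

/-- Two spikes are never adjacent, as the thorn has more than two points. -/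
theorem Thorn.exists_foot (s : R.Spike) :
    ∃ v : R.Vert, R.graph.Adj v.1 s.1 ∧ ∀ u, R.graph.Adj u s.1 → u = v.1 := by
  have : Nonempty R.carrier := ⟨s.1⟩
  obtain ⟨u, hu⟩ := Set.ncard_eq_one.1 s.2
  have hsu : R.graph.Adj s.1 u := by
    have : u ∈ R.graph.neighborSet s.1 := hu ▸ rfl
    exact this
  have huniq : ∀ w, R.graph.Adj s.1 w → w = u := fun w hw => by
    have : w ∈ R.graph.neighborSet s.1 := hw
    rw [hu] at this
    exact this
  refine ⟨⟨u, fun h => ?_⟩, hsu.symm, fun w hw => huniq w hw.symm⟩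
  obtain ⟨w, hw⟩ := Set.ncard_eq_one.1 h
  have huniq' : ∀ z, R.graph.Adj u z → z = s.1 := fun z hz => by
    have h1 : z ∈ R.graph.neighborSet u := hz
    have h2 : s.1 ∈ R.graph.neighborSet u := hsu.symm
    rw [hw] at h1 h2
    exact h1.trans h2.symm
  have hall : ∀ z, z = s.1 ∨ z = u := by
    refine preconnected_induction (R.isTree).connected.preconnected s.1 (Or.inl rfl) ?_
    rintro a b (rfl | rfl) hab
    · exact Or.inr (huniq b hab)
    · exact Or.inl (huniq' b hab)
  have h3 := R.three_le_card
  have h4 : (Set.univ : Set R.carrier).ncard ≤ ({s.1, u} : Set R.carrier).ncard :=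
    Set.ncard_le_ncard (fun z _ => hall z) (Set.toFinite _)
  have h5 := Set.ncard_insert_le s.1 ({u} : Set R.carrier)
  rw [Set.ncard_univ] at h4
  rw [Set.ncard_singleton] at h5
  omega

/-- The vertex to which a spike is attached. -/
noncomputable def Thorn.foot (s : R.Spike) : R.Vert := (Thorn.exists_foot s).choose

theorem Thorn.foot_adj (s : R.Spike) : R.graph.Adj (Thorn.foot s).1 s.1 :=
  (Thorn.exists_foot s).choose_spec.1

theorem Thorn.eq_foot {s : R.Spike} {u : R.carrier} (h : R.graph.Adj u s.1) :
    u = (Thorn.foot s).1 :=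
  (Thorn.exists_foot s).choose_spec.2 u h

theorem Thorn.vert_eq_foot {s : R.Spike} {v : R.Vert} (h : R.graph.Adj v.1 s.1) :
    v = Thorn.foot s := Subtype.ext (Thorn.eq_foot h)

instance [Nonempty R.carrier] : Nonempty R.Vert := by
  obtain ⟨c⟩ := ‹Nonempty R.carrier›
  by_cases hc : valence R.graph c = 1
  · exact ⟨Thorn.foot ⟨c, hc⟩⟩
  · exact ⟨⟨c, hc⟩⟩

/-- The number of spikes of a perfect thorn, from the count of the edges of its tree. -/
theorem Thorn.card_spike [Nonempty R.carrier] (hR : R.IsPerfect) :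
    Nat.card R.Spike + 2 * Nat.card R.Vert = (n + 1) * Nat.card R.Vert + 2 := by
  classical
  have := Fintype.ofFinite R.carrier
  have h1 := R.graph.sum_degrees_eq_twice_card_edges
  have h2 := (R.isTree).card_edgeFinset
  have hval : ∀ c, R.graph.degree c = if valence R.graph c = 1 then 1 else n + 1 := by
    intro c
    have hd : R.graph.degree c = valence R.graph c := by
      rw [valence, Set.ncard_eq_toFinset_card', SimpleGraph.degree, SimpleGraph.neighborFinset]
    split_ifs with h
    · rw [hd, h]
    · exact hd.trans (hR ⟨c, h⟩)
  have hs : Nat.card R.Spike = (Finset.univ.filter fun c => valence R.graph c = 1).card := by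
    rw [← Fintype.card_subtype, ← Nat.card_eq_fintype_card]; rfl
  have hv : Nat.card R.Vert = (Finset.univ.filter fun c => ¬ valence R.graph c = 1).card := by
    rw [← Fintype.card_subtype, ← Nat.card_eq_fintype_card]; rfl
  have hc : (Finset.univ.filter fun c => valence R.graph c = 1).card +
      (Finset.univ.filter fun c => ¬ valence R.graph c = 1).card = Fintype.card R.carrier :=
    Finset.card_filter_add_card_filter_not _
  simp only [hval, Finset.sum_ite, Finset.sum_const, smul_eq_mul, mul_one] at h1
  rw [← hs, ← hv] at h1 hc
  rw [mul_comm (n + 1)]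
  omega

theorem Thorn.nonempty_spike [Nonempty R.carrier] (hn : 2 ≤ n) (hR : R.IsPerfect) :
    Nonempty R.Spike := by
  have h := Thorn.card_spike hR
  have h2 : 2 * Nat.card R.Vert ≤ (n + 1) * Nat.card R.Vert :=
    Nat.mul_le_mul_right _ (by omega)
  exact (Nat.card_pos_iff.1 (by omega)).1

end ThornBasics

section Embedded

variable {V : Type*} {T : SimpleGraph V} {n : ℕ} {R : Thorn n}

/-- The vertices of an embedded thorn. -/
def verts (f : R.graph ↪g T) : Set V := f '' {c | valence R.graph c ≠ 1}

theorem mem_verts (f : R.graph ↪g T) {c : R.carrier} : f c ∈ verts f ↔ valence R.graph c ≠ 1 :=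
  ⟨fun ⟨_, h, e⟩ => f.injective e ▸ h, fun h => ⟨c, h, rfl⟩⟩

theorem verts_finite (f : R.graph ↪g T) : (verts f).Finite := (Set.toFinite _).image _

theorem verts_nonempty [Nonempty R.carrier] (f : R.graph ↪g T) : (verts f).Nonempty := by
  obtain ⟨v⟩ : Nonempty R.Vert := inferInstance
  exact ⟨f v.1, v.1, v.2, rfl⟩

theorem adj_spike (f : R.graph ↪g T) (s : R.Spike) : T.Adj (f (Thorn.foot s).1) (f s.1) :=
  f.map_adj_iff.2 (Thorn.foot_adj s)

/-- The edges that leave the set of vertices of an embedded perfect thorn are those of its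
spikes. -/
theorem exit_verts_iff (hval : ∀ v, valence T v = n + 1) (hR : R.IsPerfect) (f : R.graph ↪g T)
    {v x : V} : (v ∈ verts f ∧ x ∉ verts f ∧ T.Adj v x) ↔
      ∃ s : R.Spike, v = f (Thorn.foot s).1 ∧ x = f s.1 := by
  constructor
  · rintro ⟨⟨c, hc, rfl⟩, hx, h⟩
    obtain ⟨y, hy, rfl⟩ := exists_adj_preimage f (neighborSet_finite hval _)
      ((hR ⟨c, hc⟩).trans (hval _).symm) h
    rw [mem_verts, not_not] at hx
    exact ⟨⟨y, hx⟩, congrArg f (Thorn.eq_foot (s := ⟨y, hx⟩) hy), rfl⟩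
  · rintro ⟨s, rfl, rfl⟩
    exact ⟨(mem_verts f).2 (Thorn.foot s).2, fun h => (mem_verts f).1 h s.2, adj_spike f s⟩

theorem mem_branch_spike (hT : T.IsTree) (f : R.graph ↪g T) (s : R.Spike) {c : R.carrier}
    (hc : c ≠ s.1) : f c ∈ branch T (f s.1) (f (Thorn.foot s).1) := by
  have : Nonempty R.carrier := ⟨c⟩
  have hadj := (adj_spike f s).symm
  refine (preconnected_induction (R.isTree).connected.preconnected
    (P := fun c => c = s.1 ∨ f c ∈ branch T (f s.1) (f (Thorn.foot s).1)) s.1 (Or.inl rfl)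
    ?_ c).resolve_left hc
  rintro a b (rfl | ha) hab
  · rw [Thorn.eq_foot hab.symm]
    exact Or.inr (mem_branch_self _ _)
  · by_contra hb
    rw [not_or] at hb
    exact hb.1 (f.injective (branch_exit hT hadj ha hb.2 (f.map_adj_iff.2 hab)).2)

theorem isConvex_verts (hT : T.IsTree) (hval : ∀ v, valence T v = n + 1) (hR : R.IsPerfect)
    (f : R.graph ↪g T) : IsConvex T (verts f) := by
  intro v hv x hx h
  obtain ⟨s, rfl, rfl⟩ := (exit_verts_iff hval hR f).1 ⟨hv, hx, h⟩
  rintro _ ⟨c, hc, rfl⟩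
  exact mem_branch_spike hT f s (fun e => hc (e ▸ s.2))

/-- The ball of a spike of an embedded thorn. -/
def spikeBall (f : R.graph ↪g T) (s : R.Spike) : Set (Bdry T) :=
  ball T (f (Thorn.foot s).1) (f s.1)

theorem spikeBall_injective (hT : T.IsTree) (hn : 2 ≤ n) (hval : ∀ v, valence T v = n + 1)
    (f : R.graph ↪g T) : Function.Injective (spikeBall f) := fun s s' e =>
  Subtype.ext (f.injective (ball_inj hT hn hval (adj_spike f s) (adj_spike f s') e).2)

theorem exists_mem_spikeBall [Nonempty R.carrier] (hT : T.IsTree)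
    (hval : ∀ v, valence T v = n + 1) (hR : R.IsPerfect) (f : R.graph ↪g T) (x : Bdry T) :
    ∃ s, x ∈ spikeBall f s := by
  obtain ⟨v, hv, y, hy, hvy, hx⟩ := exists_exit_ball hT (verts_finite f) (verts_nonempty f) x
  obtain ⟨s, rfl, rfl⟩ := (exit_verts_iff hval hR f).1 ⟨hv, hy, hvy⟩
  exact ⟨s, hx⟩

theorem eq_of_mem_branch_spike (hT : T.IsTree) (hval : ∀ v, valence T v = n + 1)
    (hR : R.IsPerfect) (f : R.graph ↪g T) {y : V} {s s' : R.Spike}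
    (h : y ∈ branch T (f (Thorn.foot s).1) (f s.1))
    (h' : y ∈ branch T (f (Thorn.foot s').1) (f s'.1)) : s = s' := by
  obtain ⟨h1, h2, h3⟩ := (exit_verts_iff hval hR f).2 ⟨s, rfl, rfl⟩
  obtain ⟨h1', h2', h3'⟩ := (exit_verts_iff hval hR f).2 ⟨s', rfl, rfl⟩
  exact Subtype.ext (f.injective
    ((isConvex_verts hT hval hR f).exit_unique hT h1 h2 h3 h1' h2' h3' h h').2)

theorem eq_of_mem_spikeBall (hT : T.IsTree) (hval : ∀ v, valence T v = n + 1)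
    (hR : R.IsPerfect) (f : R.graph ↪g T) {x : Bdry T} {s s' : R.Spike}
    (h : x ∈ spikeBall f s) (h' : x ∈ spikeBall f s') : s = s' := by
  induction x using Quotient.inductionOn with
  | h a =>
  obtain ⟨k, hk⟩ := (mk_mem_ball_iff a _ _).1 h
  obtain ⟨l, hl⟩ := (mk_mem_ball_iff a _ _).1 h'
  exact eq_of_mem_branch_spike hT hval hR f (hk _ (le_max_left k l)) (hl _ (le_max_right k l))

theorem mem_verts_iff [Nonempty R.carrier] (hT : T.IsTree) (hval : ∀ v, valence T v = n + 1)
    (hR : R.IsPerfect) (f : R.graph ↪g T) (y : V) :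
    y ∈ verts f ↔ ∀ s : R.Spike, y ∉ branch T (f (Thorn.foot s).1) (f s.1) := by
  constructor
  · rintro ⟨c, hc, rfl⟩ s
    exact (notMem_branch_iff hT (adj_spike f s)).2
      (mem_branch_spike hT f s (fun e => hc (e ▸ s.2)))
  · intro h
    by_contra hy
    obtain ⟨v, hv, x, hx, hvx, hb⟩ := exists_exit hT (verts_nonempty f) hy
    obtain ⟨s, rfl, rfl⟩ := (exit_verts_iff hval hR f).1 ⟨hv, hx, hvx⟩
    exact h s hb

theorem mem_range_iff (f : R.graph ↪g T) (y : V) :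
    y ∈ Set.range f ↔ y ∈ verts f ∨ ∃ s : R.Spike, y = f s.1 := by
  constructor
  · rintro ⟨c, rfl⟩
    by_cases hc : valence R.graph c = 1
    · exact Or.inr ⟨⟨c, hc⟩, rfl⟩
    · exact Or.inl ((mem_verts f).2 hc)
  · rintro (⟨c, -, rfl⟩ | ⟨s, rfl⟩)
    · exact ⟨c, rfl⟩
    · exact ⟨s.1, rfl⟩

/-- Two embedded thorns with the same balls of spikes have the same image. -/
theorem exists_iso_of_spikeBall (hT : T.IsTree) (hn : 2 ≤ n) (hval : ∀ v, valence T v = n + 1)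
    {R' : Thorn n} (hR : R.IsPerfect) (hR' : R'.IsPerfect) (f : R.graph ↪g T)
    (f' : R'.graph ↪g T) (h : ∀ B, (∃ s, B = spikeBall f s) ↔ ∃ s, B = spikeBall f' s) :
    ∃ F : R.graph ≃g R'.graph, ∀ c, f' (F c) = f c := by
  have edge : ∀ s, ∃ s' : R'.Spike,
      f (Thorn.foot s).1 = f' (Thorn.foot s').1 ∧ f s.1 = f' s'.1 := by
    intro s
    obtain ⟨s', e⟩ := (h _).1 ⟨s, rfl⟩
    exact ⟨s', ball_inj hT hn hval (adj_spike f s) (adj_spike f' s') e⟩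
  have edge' : ∀ s', ∃ s : R.Spike,
      f (Thorn.foot s).1 = f' (Thorn.foot s').1 ∧ f s.1 = f' s'.1 := by
    intro s'
    obtain ⟨s, e⟩ := (h _).2 ⟨s', rfl⟩
    exact ⟨s, ball_inj hT hn hval (adj_spike f s) (adj_spike f' s') e.symm⟩
  have hrange : Set.range f = Set.range f' := by
    rcases isEmpty_or_nonempty R.carrier with hE | hN
    · have hE' : IsEmpty R'.carrier := by
        by_contra hcon
        rw [not_isEmpty_iff] at hcon
        obtain ⟨s'⟩ := Thorn.nonempty_spike hn hR'
        obtain ⟨s, -⟩ := edge' s'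
        exact hE.false s.1
      rw [Set.range_eq_empty, Set.range_eq_empty]
    · have : Nonempty R'.carrier := by
        obtain ⟨s⟩ := Thorn.nonempty_spike hn hR
        obtain ⟨s', -⟩ := edge s
        exact ⟨s'.1⟩
      have hv : verts f = verts f' := by
        ext y
        rw [mem_verts_iff hT hval hR, mem_verts_iff hT hval hR']
        constructor
        · intro hy s'
          obtain ⟨s, e1, e2⟩ := edge' s'
          rw [← e1, ← e2]
          exact hy s
        · intro hy s
          obtain ⟨s', e1, e2⟩ := edge s
          rw [e1, e2]
          exact hy s'
      ext y
      rw [mem_range_iff, mem_range_iff, hv]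
      refine or_congr_right ⟨?_, ?_⟩
      · rintro ⟨s, rfl⟩
        obtain ⟨s', -, e⟩ := edge s
        exact ⟨s', e⟩
      · rintro ⟨s', rfl⟩
        obtain ⟨s, -, e⟩ := edge' s'
        exact ⟨s, e.symm⟩
  let F : R.carrier ≃ R'.carrier := (Equiv.ofInjective f f.injective).trans
    ((Equiv.setCongr hrange).trans (Equiv.ofInjective f' f'.injective).symm)
  have hF : ∀ c, f' (F c) = f c := fun c =>
    Equiv.apply_ofInjective_symm f'.injective _
  refine ⟨⟨F, fun {a b} => ?_⟩, hF⟩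
  rw [← f'.map_adj_iff, hF, hF, f.map_adj_iff]

/-- Two embeddings of a thorn differ by an automorphism of the tree. -/
theorem exists_iso_embeddings [Nonempty R.carrier] (hT : T.IsTree)
    (hval : ∀ v, valence T v = n + 1) (f f' : R.graph ↪g T) :
    ∃ u : T ≃g T, ∀ c, u (f c) = f' c := by
  have hinv : ∀ c, Function.invFun f (f c) = c := Function.leftInverse_invFun f.injective
  obtain ⟨u, hu⟩ := exists_iso_extending hT hval
    (IsConvex.range (R.isTree).connected.preconnected hT (f : R.graph →g T))
    (Set.range_nonempty _) (fun v => f' (Function.invFun f v))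
    (by
      rintro _ ⟨a, rfl⟩ _ ⟨b, rfl⟩ h
      change T.Adj (f' (Function.invFun f (f a))) (f' (Function.invFun f (f b)))
      rw [hinv, hinv, f'.map_adj_iff]
      exact f.map_adj_iff.1 h)
    (by
      rintro _ ⟨a, rfl⟩ _ ⟨b, rfl⟩ h
      change f' (Function.invFun f (f a)) = f' (Function.invFun f (f b)) at h
      rw [hinv, hinv] at h
      rw [f'.injective h])
  refine ⟨u, fun c => ?_⟩
  have := hu (f c) ⟨c, rfl⟩
  rwa [hinv] at this

/-- Every thorn embeds in the tree. -/
theorem exists_embedding_thorn (hT : T.IsTree) (hval : ∀ v, valence T v = n + 1) (R : Thorn n) :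
    Nonempty (R.graph ↪g T) := by
  rcases isEmpty_or_nonempty R.carrier with hE | ⟨⟨c⟩⟩
  · exact ⟨⟨⟨fun c => hE.elim c, fun c => hE.elim c⟩, fun {c} => hE.elim c⟩⟩
  · have : Nonempty R.carrier := ⟨c⟩
    obtain ⟨v⟩ := hT.connected.nonempty
    obtain ⟨F, -⟩ := exists_embedding_extending R.isTree hT (fun _ => Set.toFinite _)
      (fun w t => (R.valence_le w).trans (hval t).ge) (IsConvex.singleton c) ⟨c, rfl⟩
      (fun _ => v)
      (by rintro _ rfl _ rfl h; exact absurd rfl h.ne)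
      (by rintro _ rfl _ rfl _; rfl)
    exact ⟨F⟩

/-- A finite subtree, together with the edges that leave it, is a perfect thorn. -/
theorem exists_thorn (hT : T.IsTree) (hn : 2 ≤ n) (hval : ∀ v, valence T v = n + 1) {S : Set V}
    (hfin : S.Finite) (hne : S.Nonempty) (hS : IsConvex T S) :
    ∃ (R : Thorn n) (f : R.graph ↪g T), R.IsPerfect ∧ Nonempty R.carrier ∧ verts f = S := by
  let C : Set V := S ∪ ⋃ v ∈ S, T.neighborSet v
  have hC : C.Finite := hfin.union (hfin.biUnion fun v _ => neighborSet_finite hval v)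
  have memC : ∀ {v x}, v ∈ S → T.Adj v x → x ∈ C := fun hv hx =>
    Or.inr (Set.mem_biUnion hv hx)
  have ofC : ∀ {x}, x ∈ C → x ∉ S → ∃ v ∈ S, T.Adj v x := by
    rintro x (hx | hx) hx'
    · exact absurd hx hx'
    · obtain ⟨v, hv, h⟩ := Set.mem_iUnion₂.1 hx
      exact ⟨v, hv, h⟩
  have := hC.to_subtype
  let e := Finite.equivFin C
  let f : Fin (Nat.card C) ↪ V := e.symm.toEmbedding.trans (Function.Embedding.subtype _)
  have hfC : ∀ i, f i ∈ C := fun i => (e.symm i).2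
  have hf : ∀ {x}, x ∈ C → ∃ i, f i = x := fun {x} hx =>
    ⟨e ⟨x, hx⟩, congrArg Subtype.val (e.symm_apply_apply ⟨x, hx⟩)⟩
  let G : SimpleGraph (Fin (Nat.card C)) := T.comap f
  have himg : ∀ i, valence G i = (T.neighborSet (f i) ∩ C).ncard := by
    intro i
    rw [valence, ← Set.ncard_image_of_injective _ f.injective]
    congr 1
    ext x
    constructor
    · rintro ⟨j, hj, rfl⟩
      exact ⟨hj, hfC j⟩
    · rintro ⟨hx, hxC⟩
      obtain ⟨j, rfl⟩ := hf hxC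
      exact ⟨j, hx, rfl⟩
  have val1 : ∀ i, f i ∈ S → valence G i = n + 1 := by
    intro i hi
    rw [himg, ← hval (f i), valence]
    congr 1
    exact Set.inter_eq_left.2 fun x hx => memC hi hx
  have val2 : ∀ i, f i ∉ S → valence G i = 1 := by
    intro i hi
    obtain ⟨v, hv, hvx⟩ := ofC (hfC i) hi
    rw [himg, Set.ncard_eq_one]
    refine ⟨v, Set.Subset.antisymm ?_ ?_⟩
    · rintro y ⟨hy, hyC⟩
      by_cases hyS : y ∈ S
      · exact hS.adj_unique hT hi hv hyS hvx (SimpleGraph.Adj.symm hy)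
      · -- a neighbour of `y` in `S` would lie behind the edge from `v` to `f i`
        obtain ⟨w, hw, hwy⟩ := ofC hyC hyS
        by_contra hne
        have hwb := hS v hv _ hi hvx hw
        have hyb := branch_nested hT hvx hy hne (mem_branch_self _ _)
        have := (branch_exit hT hvx hyb ((notMem_branch_iff hT hvx).2 hwb) hwy.symm).1
        exact SimpleGraph.Adj.ne hy this.symm
    · rintro _ rfl
      exact ⟨hvx.symm, Or.inl hv⟩
  obtain ⟨v₀, hv₀⟩ := hne
  obtain ⟨i₀, hi₀⟩ := hf (Or.inl hv₀ : v₀ ∈ C)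
  have reachS : ∀ i, f i ∈ S → G.Reachable i₀ i := by
    intro i hi
    by_contra hcon
    let D : Set V := {v | v ∈ S ∧ ∃ j, f j = v ∧ G.Reachable i₀ j}
    have hiD : f i ∉ D := by
      rintro ⟨-, j, hj, hr⟩
      exact hcon (f.injective hj ▸ hr)
    obtain ⟨v, ⟨hvS, j, rfl, hj⟩, x, hx, hvx, hb⟩ :=
      exists_exit hT (A := D) ⟨v₀, hv₀, i₀, hi₀, SimpleGraph.Reachable.refl _⟩ hiD
    obtain ⟨l, rfl⟩ := hf (memC hvS hvx)
    have hxS : f l ∉ S := fun h => hx ⟨h, l, rfl, hj.trans (SimpleGraph.Adj.reachable hvx)⟩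
    exact (notMem_branch_iff hT hvx).2 (hS _ hvS _ hxS hvx hi) hb
  have reach : ∀ i, G.Reachable i₀ i := by
    intro i
    by_cases hi : f i ∈ S
    · exact reachS i hi
    · obtain ⟨v, hv, h⟩ := ofC (hfC i) hi
      obtain ⟨j, rfl⟩ := hf (Or.inl hv : v ∈ C)
      exact (reachS j hv).trans (SimpleGraph.Adj.reachable (G := G) h)
  have hG : G.IsTree :=
    { preconnected := fun i j => (reach i).symm.trans (reach j)
      nonempty := ⟨i₀⟩
      isAcyclic := hT.isAcyclic.of_comap f }
  have hcard : 3 ≤ Nat.card (Fin (Nat.card C)) := by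
    have h1 := val1 i₀ (hi₀ ▸ hv₀)
    have h2 := Set.ncard_le_card (G.neighborSet i₀)
    unfold valence at h1
    omega
  refine ⟨⟨Fin (Nat.card C), G, inferInstance, Or.inr ⟨hG, hcard, fun i => ?_⟩⟩,
    SimpleGraph.Embedding.comap f T, ?_, ⟨i₀⟩, ?_⟩
  · by_cases hi : f i ∈ S
    · exact (val1 i hi).le
    · rw [val2 i hi]; omega
  · rintro ⟨i, hi⟩
    by_cases hiS : f i ∈ S
    · exact val1 i hiS
    · exact absurd (val2 i hiS) hi
  · ext x
    constructor
    · rintro ⟨i, hi, rfl⟩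
      by_contra hiS
      exact hi (val2 i hiS)
    · intro hx
      obtain ⟨i, rfl⟩ := hf (Or.inl hx : x ∈ C)
      refine ⟨i, fun h => ?_, rfl⟩
      have h1 := val1 i hx
      have h : valence G i = 1 := h
      omega

end Embedded

/-! ### The bi-thorn of a spheromorphism -/

section BiThorns

variable {V : Type*} {T : SimpleGraph V} {n : ℕ}

theorem isBiThornOf_iff {g : Bdry T ≃ₜ Bdry T} {β : BiThorn n} :
    IsBiThornOf g β ↔ ∃ (f : β.R.graph ↪g T) (h : β.Q.graph ↪g T),
      (∀ B, Maximal (Regards T g) B ↔ ∃ s, B = spikeBall f s) ∧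
      ∀ s, g '' spikeBall f s = spikeBall h (β.θ s) := by
  refine exists_congr fun f => exists_congr fun h => and_congr ?_ ?_
  · refine forall_congr' fun B => iff_congr Iff.rfl ⟨?_, ?_⟩
    · rintro ⟨v, s, hvs, rfl⟩
      exact ⟨s, by rw [Thorn.vert_eq_foot hvs, spikeBall]⟩
    · rintro ⟨s, rfl⟩
      exact ⟨Thorn.foot s, s, Thorn.foot_adj s, rfl⟩
  · constructor
    · exact fun H s => H _ s _ (Thorn.foot_adj s) (Thorn.foot_adj (β.θ s))
    · intro H v s w hvs hws
      rw [Thorn.vert_eq_foot hvs, Thorn.vert_eq_foot hws]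
      exact H s

/-- Behind each spike, `g` is an automorphism that carries the spike `s` to the spike `θ s`. -/
theorem exists_iso_spike (hT : T.IsTree) (hn : 2 ≤ n) (hval : ∀ v, valence T v = n + 1)
    {g : Bdry T ≃ₜ Bdry T} {β : BiThorn n} {f : β.R.graph ↪g T} {h : β.Q.graph ↪g T}
    (hmax : ∀ B, Maximal (Regards T g) B ↔ ∃ s, B = spikeBall f s)
    (him : ∀ s, g '' spikeBall f s = spikeBall h (β.θ s)) (s : β.R.Spike) :
    ∃ r : T ≃g T, (∀ x ∈ spikeBall f s, g x = bdryMap r x) ∧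
      r (f (Thorn.foot s).1) = h (Thorn.foot (β.θ s)).1 ∧ r (f s.1) = h (β.θ s).1 := by
  obtain ⟨p, q, hpq, e, hag⟩ := (regards_iff hT hval g _).1 ((hmax _).2 ⟨s, rfl⟩).prop
  obtain ⟨rfl, rfl⟩ := ball_inj hT hn hval (adj_spike f s) hpq e
  obtain ⟨r, hr⟩ := hag
  refine ⟨r, hr, ?_⟩
  refine ball_inj hT hn hval (r.map_adj_iff.2 (adj_spike f s)) (adj_spike h _) ?_
  rw [← image_ball_of_eqOn hr]
  exact him s

/-- At most one of the edges of the tree at a terminal vertex is not the edge of a spike. -/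
theorem exists_terminal_edge (hn : 2 ≤ n) (hval : ∀ v, valence T v = n + 1) {R : Thorn n}
    (hR : R.IsPerfect) (f : R.graph ↪g T) {a : R.Vert} (ha : R.IsTerminal a) :
    ∃ p, T.Adj p (f a.1) ∧ ∀ y, T.Adj (f a.1) y → y ≠ p →
      ∃ s : R.Spike, R.graph.Adj a.1 s.1 ∧ f s.1 = y := by
  have nb : ∀ {y}, T.Adj (f a.1) y → ∃ c, R.graph.Adj a.1 c ∧ f c = y := fun hy =>
    exists_adj_preimage f (neighborSet_finite hval _) ((hR a).trans (hval _).symm) hy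
  by_cases hw : ∃ w : R.Vert, R.graph.Adj a.1 w.1
  · obtain ⟨w, hw⟩ := hw
    refine ⟨f w.1, (f.map_adj_iff.2 hw).symm, fun y hy hne => ?_⟩
    obtain ⟨c, hc, rfl⟩ := nb hy
    by_cases hcs : valence R.graph c = 1
    · exact ⟨⟨c, hcs⟩, hc, rfl⟩
    · have := (Set.ncard_le_one (Set.toFinite _)).1 ha ⟨c, hcs⟩ hc w hw
      exact absurd (congrArg (fun z : R.Vert => f z.1) this) hne
  · obtain ⟨p, hp, -⟩ := exists_adj_ne_ne hn hval (f a.1) (f a.1) (f a.1)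
    refine ⟨p, hp.symm, fun y hy _ => ?_⟩
    obtain ⟨c, hc, rfl⟩ := nb hy
    by_cases hcs : valence R.graph c = 1
    · exact ⟨⟨c, hcs⟩, hc, rfl⟩
    · exact absurd ⟨⟨c, hcs⟩, hc⟩ hw

/-- At a pair of similar vertices the isomorphisms of the branches could be glued, so that the balls
of the spikes would not be maximal. -/
theorem isMinimal_of_isBiThornOf (hT : T.IsTree) (hn : 2 ≤ n) (hval : ∀ v, valence T v = n + 1)
    {g : Bdry T ≃ₜ Bdry T} {β : BiThorn n} (hβ : IsBiThornOf g β) : β.IsMinimal := by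
  obtain ⟨f, h, hmax, him⟩ := isBiThornOf_iff.1 hβ
  rintro a b ⟨ha, -, hab⟩
  obtain ⟨p, hp, hsp⟩ := exists_terminal_edge hn hval β.perfect_R f ha
  have hloc : ∀ y, ∃ ρ : T ≃g T, T.Adj (f a.1) y → y ≠ p → ρ (f a.1) = h b.1 ∧
      (∀ x ∈ ball T (f a.1) y, g x = bdryMap ρ x) ∧
      ∃ s : β.R.Spike, f s.1 = y ∧ ρ y = h (β.θ s).1 := by
    intro y
    by_cases hy : T.Adj (f a.1) y ∧ y ≠ p
    · obtain ⟨s, has, rfl⟩ := hsp y hy.1 hy.2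
      obtain ⟨r, h1, h2, h3⟩ := exists_iso_spike hT hn hval hmax him s
      rw [spikeBall, ← Thorn.vert_eq_foot has] at h1
      rw [← Thorn.vert_eq_foot has, ← Thorn.vert_eq_foot (hab s has)] at h2
      exact ⟨r, fun _ _ => ⟨h2, h1, s, rfl, h3⟩⟩
    · exact ⟨1, fun h1 h2 => absurd ⟨h1, h2⟩ hy⟩
  choose ρ hρ using hloc
  obtain ⟨r, hr⟩ := exists_iso_star hT hval hp ρ (fun y hy hyp => (hρ y hy hyp).1) (by
    intro y z hy hyp hz hzp e
    obtain ⟨-, -, s, hs, hs'⟩ := hρ y hy hyp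
    obtain ⟨-, -, t, ht, ht'⟩ := hρ z hz hzp
    rw [hs', ht'] at e
    have := β.θ.injective (Subtype.ext (h.injective e))
    rw [← hs, ← ht, this])
  have hag : AgreesOn g p (f a.1) := by
    refine ⟨r, fun x hx => ?_⟩
    obtain ⟨_, rfl, y, -, hy, hxy⟩ := exists_exit_ball hT (Set.finite_singleton (f a.1)) ⟨_, rfl⟩ x
    have hyp : y ≠ p := by
      rintro rfl
      exact (notMem_ball_iff hT hp).2 hxy hx
    rw [(hρ y hy hyp).2.1 x hxy]
    exact bdryMap_congr (fun v hv => (hr y hy hyp v hv).symm) hxy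
  obtain ⟨y, hy, hyp, -⟩ := exists_adj_ne_ne hn hval (f a.1) p p
  obtain ⟨s, has, rfl⟩ := hsp y hy hyp
  have hball : spikeBall f s = ball T (f a.1) (f s.1) := by
    rw [spikeBall, ← Thorn.vert_eq_foot has]
  have hle := ((hmax _).2 ⟨s, hball.symm⟩).le_of_ge
    ((regards_iff hT hval g _).2 ⟨_, _, hp, rfl, hag⟩)
    (ball_mono (branch_nested hT hp hy hyp))
  exact notMem_branch hT hy ((ball_subset_iff hT hn hval hp hy).1 hle (mem_branch_self _ _))

theorem spikeBall_spikeMap {R R' : Thorn n} (F : R.graph ≃g R'.graph) {f : R.graph ↪g T}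
    {f' : R'.graph ↪g T} (e : ∀ c, f' (F c) = f c) (s : R.Spike) :
    spikeBall f' (Thorn.spikeMap F s) = spikeBall f s := by
  have h : F (Thorn.foot s).1 = (Thorn.foot (Thorn.spikeMap F s)).1 :=
    Thorn.eq_foot (F.map_adj_iff.2 (Thorn.foot_adj s))
  rw [spikeBall, ← h, e]
  exact congrArg _ (e s.1)

theorem spikeMap_symm {R R' : Thorn n} (F : R.graph ≃g R'.graph) (s : R'.Spike) :
    Thorn.spikeMap F (Thorn.spikeMap F.symm s) = s :=
  Subtype.ext (F.apply_symm_apply s.1)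

theorem isBiThornOf_of_isomorphic {g : Bdry T ≃ₜ Bdry T} {β β' : BiThorn n}
    (h : BiThorn.Isomorphic β β') (hβ : IsBiThornOf g β) : IsBiThornOf g β' := by
  obtain ⟨F, H, hFH⟩ := h
  obtain ⟨f, h, hmax, him⟩ := isBiThornOf_iff.1 hβ
  have ef : ∀ c, (F.symm.toEmbedding.trans f) (F c) = f c := fun c =>
    congrArg f (F.symm_apply_apply c)
  have eh : ∀ c, (H.symm.toEmbedding.trans h) (H c) = h c := fun c =>
    congrArg h (H.symm_apply_apply c)
  refine isBiThornOf_iff.2 ⟨F.symm.toEmbedding.trans f, H.symm.toEmbedding.trans h, ?_, ?_⟩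
  · intro B
    rw [hmax]
    constructor
    · rintro ⟨s, rfl⟩
      exact ⟨Thorn.spikeMap F s, (spikeBall_spikeMap F ef s).symm⟩
    · rintro ⟨s, rfl⟩
      refine ⟨Thorn.spikeMap F.symm s, ?_⟩
      rw [← spikeBall_spikeMap F ef, spikeMap_symm]
  · intro s
    have h1 := him (Thorn.spikeMap F.symm s)
    rw [← spikeBall_spikeMap F ef, ← spikeBall_spikeMap H eh, hFH, spikeMap_symm] at h1
    exact h1

/-- The bi-thorn of a spheromorphism is unique up to isomorphism. -/
theorem isomorphic_of_isBiThornOf (hT : T.IsTree) (hn : 2 ≤ n) (hval : ∀ v, valence T v = n + 1)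
    {g : Bdry T ≃ₜ Bdry T} {β β' : BiThorn n} (hβ : IsBiThornOf g β) (hβ' : IsBiThornOf g β') :
    BiThorn.Isomorphic β β' := by
  obtain ⟨f, h, hmax, him⟩ := isBiThornOf_iff.1 hβ
  obtain ⟨f', h', hmax', him'⟩ := isBiThornOf_iff.1 hβ'
  have e1 : ∀ B, (∃ s, B = spikeBall f s) ↔ ∃ s, B = spikeBall f' s := fun B =>
    (hmax B).symm.trans (hmax' B)
  have e2 : ∀ {β : BiThorn n} {f : β.R.graph ↪g T} {h : β.Q.graph ↪g T},
      (∀ s, g '' spikeBall f s = spikeBall h (β.θ s)) → ∀ B,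
      ((∃ t, B = spikeBall h t) ↔ ∃ C, (∃ s, C = spikeBall f s) ∧ B = g '' C) := by
    intro β f h him B
    constructor
    · rintro ⟨t, rfl⟩
      exact ⟨_, ⟨β.θ.symm t, rfl⟩, by rw [him, Equiv.apply_symm_apply]⟩
    · rintro ⟨_, ⟨s, rfl⟩, rfl⟩
      exact ⟨_, him s⟩
  obtain ⟨F, hF⟩ := exists_iso_of_spikeBall hT hn hval β.perfect_R β'.perfect_R f f' e1
  obtain ⟨H, hH⟩ := exists_iso_of_spikeBall hT hn hval β.perfect_Q β'.perfect_Q h h'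
    (fun B => by rw [e2 him, e2 him']; simp only [e1])
  refine ⟨F, H, fun s => spikeBall_injective hT hn hval h' ?_⟩
  rw [spikeBall_spikeMap H hH, ← him, ← him', spikeBall_spikeMap F hF]

/-! ### Invariance under automorphisms -/

theorem maximal_image_iff {X Y : Type*} (e : X ≃ Y) {P : Set X → Prop} {Q : Set Y → Prop}
    (h : ∀ B, P B ↔ Q (e '' B)) (B : Set X) : Maximal P B ↔ Maximal Q (e '' B) := by
  constructor
  · intro hB
    refine ⟨(h B).1 hB.prop, fun C hC hle => ?_⟩
    have hC' : C = e '' (e.symm '' C) := (e.image_symm_image C).symm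
    rw [hC'] at hC hle ⊢
    exact Set.image_mono (hB.le_of_ge ((h _).2 hC) ((Set.image_subset_image_iff e.injective).1 hle))
  · intro hB
    refine ⟨(h B).2 hB.prop, fun C hC hle => ?_⟩
    exact (Set.image_subset_image_iff e.injective).1
      (hB.le_of_ge ((h C).1 hC) (Set.image_mono hle))

theorem bdryMap_inv_bdryMap (r : T ≃g T) (x : Bdry T) : bdryMap r⁻¹ (bdryMap r x) = x := by
  rw [← bdryMap_mul, inv_mul_cancel, bdryMap_one]

theorem bdryMap_bdryMap_inv (r : T ≃g T) (x : Bdry T) : bdryMap r (bdryMap r⁻¹ x) = x := by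
  rw [← bdryMap_mul, mul_inv_cancel, bdryMap_one]

theorem agreesOn_comp_iff {g g' : Bdry T → Bdry T} {a b : T ≃g T}
    (hg : ∀ x, g' x = bdryMap a (g (bdryMap b x))) (p q : V) :
    AgreesOn g' p q ↔ AgreesOn g (b p) (b q) := by
  constructor
  · rintro ⟨r, hr⟩
    refine ⟨a⁻¹ * r * b⁻¹, fun x hx => ?_⟩
    rw [← image_ball] at hx
    obtain ⟨y, hy, rfl⟩ := hx
    rw [bdryMap_mul, bdryMap_mul, bdryMap_inv_bdryMap, ← hr y hy, hg, bdryMap_inv_bdryMap]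
  · rintro ⟨r, hr⟩
    refine ⟨a * r * b, fun x hx => ?_⟩
    rw [hg, hr _ (bdryMap_mem_ball b hx), bdryMap_mul, bdryMap_mul]

theorem regards_comp_iff (hT : T.IsTree) (hval : ∀ v, valence T v = n + 1)
    {g g' : Bdry T ≃ₜ Bdry T} {a b : T ≃g T} (hg : ∀ x, g' x = bdryMap a (g (bdryMap b x)))
    (B : Set (Bdry T)) : Regards T g' B ↔ Regards T g (autBdry T b '' B) := by
  rw [regards_iff hT hval, regards_iff hT hval]
  constructor
  · rintro ⟨p, q, hpq, rfl, h⟩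
    exact ⟨b p, b q, b.map_adj_iff.2 hpq, image_ball b p q, (agreesOn_comp_iff hg p q).1 h⟩
  · rintro ⟨p, q, hpq, e, h⟩
    refine ⟨b⁻¹ p, b⁻¹ q, (b⁻¹).map_adj_iff.2 hpq, ?_, ?_⟩
    · rw [← image_ball, ← e, Set.image_image]
      refine Eq.trans (Set.image_id' B).symm (Set.image_congr fun x _ => ?_)
      exact (bdryMap_inv_bdryMap b x).symm
    · rw [agreesOn_comp_iff hg, RelIso.apply_inv_self, RelIso.apply_inv_self]
      exact h

theorem spikeBall_trans {R : Thorn n} (f : R.graph ↪g T) (r : T ≃g T) (s : R.Spike) :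
    spikeBall (f.trans r.toEmbedding) s = bdryMap r '' spikeBall f s :=
  (image_ball r _ _).symm

theorem isBiThornOf_comp (hT : T.IsTree) (hval : ∀ v, valence T v = n + 1)
    {g g' : Bdry T ≃ₜ Bdry T} {a b : T ≃g T} (hg : ∀ x, g' x = bdryMap a (g (bdryMap b x)))
    {β : BiThorn n} (hβ : IsBiThornOf g β) : IsBiThornOf g' β := by
  obtain ⟨f, h, hmax, him⟩ := isBiThornOf_iff.1 hβ
  refine isBiThornOf_iff.2 ⟨f.trans (b⁻¹).toEmbedding, h.trans a.toEmbedding, ?_, ?_⟩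
  · intro B
    have h1 := maximal_image_iff (autBdry T b).toEquiv (regards_comp_iff hT hval hg) B
    refine h1.trans ((hmax _).trans (exists_congr fun s => ?_))
    rw [spikeBall_trans]
    constructor
    · intro e
      rw [← e]
      refine Eq.trans (Set.image_id' B).symm ?_
      rw [Set.image_image]
      exact Set.image_congr fun x _ => (bdryMap_inv_bdryMap b x).symm
    · rintro rfl
      rw [Set.image_image]
      refine Eq.trans (Set.image_congr fun x _ => ?_) (Set.image_id' _)
      exact bdryMap_bdryMap_inv b x
  · intro s
    rw [spikeBall_trans, spikeBall_trans, ← him, Set.image_image, Set.image_image]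
    refine Set.image_congr fun x _ => ?_
    rw [hg, bdryMap_bdryMap_inv]

/-! ### Spheromorphisms with the same bi-thorn -/

theorem isAut_of_not_maximal (hT : T.IsTree) (hn : 2 ≤ n) (hval : ∀ v, valence T v = n + 1)
    {g : Bdry T ≃ₜ Bdry T} (hg : g ∈ Hier T) (h : ∀ B, ¬ Maximal (Regards T g) B) : IsAut g := by
  by_contra hng
  obtain ⟨v, hv⟩ := core_nonempty hT hn hval hg hng
  obtain ⟨y, hy, -⟩ := exists_adj_ne_ne hn hval v v v
  obtain ⟨x, -⟩ := ball_nonempty hT hn hval hy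
  obtain ⟨v, hv, x, hx, hvx, -⟩ := exists_exit_ball hT (core_finite hT hval hg) ⟨v, hv⟩ x
  exact h _ ((maximal_regards_iff hT hn hval hng _).2 ⟨v, hv, x, hx, hvx, rfl⟩)

/-- Automorphisms on the branches behind the spikes of an embedded thorn that fix the ends of the
spikes have a common extension. -/
theorem exists_iso_glue_spikes (hT : T.IsTree) (hval : ∀ v, valence T v = n + 1) {R : Thorn n}
    (hR : R.IsPerfect) (f : R.graph ↪g T) (t : R.Spike → (T ≃g T))
    (ht : ∀ s, t s (f (Thorn.foot s).1) = f (Thorn.foot s).1) (ht' : ∀ s, t s (f s.1) = f s.1) :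
    ∃ τ : T ≃g T, ∀ s, ∀ v ∈ branch T (f (Thorn.foot s).1) (f s.1), τ v = t s v := by
  classical
  let F : V → V := fun v =>
    if h : ∃ s : R.Spike, v ∈ branch T (f (Thorn.foot s).1) (f s.1) then t h.choose v else v
  have F1 : ∀ s, ∀ v ∈ branch T (f (Thorn.foot s).1) (f s.1), F v = t s v := by
    intro s v hv
    have hex : ∃ s : R.Spike, v ∈ branch T (f (Thorn.foot s).1) (f s.1) := ⟨s, hv⟩
    simp only [F, dif_pos hex, eq_of_mem_branch_spike hT hval hR f hex.choose_spec hv]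
  have F2 : ∀ v, (¬ ∃ s : R.Spike, v ∈ branch T (f (Thorn.foot s).1) (f s.1)) → F v = v :=
    fun v h => dif_neg h
  have Ffoot : ∀ s, F (f (Thorn.foot s : R.Vert).1) = f (Thorn.foot s).1 := by
    intro s
    refine F2 _ ?_
    rintro ⟨s', hs'⟩
    exact (notMem_branch_iff hT (adj_spike f s')).2
      (mem_branch_spike hT f s' (c := (Thorn.foot s).1)
        (fun e => (Thorn.foot s).2 (e ▸ s'.2))) hs'
  obtain ⟨τ, hτ⟩ := exists_iso_of_locally hT hval F (fun v => by
    by_cases hv : ∃ s : R.Spike, v ∈ branch T (f (Thorn.foot s).1) (f s.1)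
    · obtain ⟨s, hs⟩ := hv
      refine ⟨t s, F1 s v hs, fun x hx => ?_⟩
      by_cases hxb : x ∈ branch T (f (Thorn.foot s).1) (f s.1)
      · exact F1 s x hxb
      · rw [(branch_exit hT (adj_spike f s) hs hxb hx).2, Ffoot, ht]
    · refine ⟨1, F2 v hv, fun x hx => ?_⟩
      by_cases hxb : ∃ s : R.Spike, x ∈ branch T (f (Thorn.foot s).1) (f s.1)
      · obtain ⟨s, hs⟩ := hxb
        have e := (branch_exit hT (adj_spike f s) hs (fun h => hv ⟨s, h⟩) hx.symm).1
        rw [F1 s x hs, e, ht']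
        rfl
      · exact F2 x hxb)
  exact ⟨τ, fun s v hv => (hτ v).trans (F1 s v hv)⟩

theorem nonempty_R_iff (β : BiThorn n) : Nonempty β.R.carrier ↔ Nonempty β.Q.carrier := by
  have key : ∀ R : Thorn n, Nonempty R.carrier ↔ 0 < Nat.card R.Vert := by
    intro R
    rw [Finite.card_pos_iff]
    exact ⟨fun _ => inferInstance, fun ⟨v⟩ => ⟨v.1⟩⟩
  rw [key, key, β.card_eq]

/-- The bi-thorn determines the double coset: after the embeddings have been matched by `u` and `w`,
the two spheromorphisms differ by automorphisms of the branches behind the spikes. -/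
theorem exists_comp_of_isBiThornOf (hT : T.IsTree) (hn : 2 ≤ n)
    (hval : ∀ v, valence T v = n + 1) {g g' : Bdry T ≃ₜ Bdry T} (hg : g ∈ Hier T)
    (hg' : g' ∈ Hier T) {β : BiThorn n} (hβ : IsBiThornOf g β) (hβ' : IsBiThornOf g' β) :
    ∃ a b : T ≃g T, ∀ x, g' x = bdryMap a (g (bdryMap b x)) := by
  obtain ⟨f, h, hmax, him⟩ := isBiThornOf_iff.1 hβ
  obtain ⟨f', h', hmax', him'⟩ := isBiThornOf_iff.1 hβ'
  rcases isEmpty_or_nonempty β.R.carrier with hE | hN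
  · have aut : ∀ {g : Bdry T ≃ₜ Bdry T} {f : β.R.graph ↪g T}, g ∈ Hier T →
        (∀ B, Maximal (Regards T g) B ↔ ∃ s, B = spikeBall f s) → IsAut g := fun hg hmax =>
      isAut_of_not_maximal hT hn hval hg fun B hB => by
        obtain ⟨s, -⟩ := (hmax B).1 hB
        exact hE.false s.1
    obtain ⟨r, hr⟩ := aut hg hmax
    obtain ⟨r', hr'⟩ := aut hg' hmax'
    exact ⟨r' * r⁻¹, 1, fun x => by
      rw [bdryMap_one, hr, hr', bdryMap_mul, bdryMap_inv_bdryMap]⟩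
  · have := (nonempty_R_iff β).1 hN
    obtain ⟨u, hu⟩ := exists_iso_embeddings hT hval f f'
    obtain ⟨w, hw⟩ := exists_iso_embeddings hT hval h h'
    choose r hr1 hr2 hr3 using exists_iso_spike hT hn hval hmax him
    choose r' hr1' hr2' hr3' using exists_iso_spike hT hn hval hmax' him'
    have fix : ∀ s c d, r s (f c) = h d → r' s (f' c) = h' d →
        ((r s)⁻¹ * w⁻¹ * r' s * u) (f c) = f c := by
      intro s c d e e'
      change (r s)⁻¹ (w⁻¹ (r' s (u (f c)))) = f c
      rw [hu, e', ← hw, RelIso.inv_apply_self, ← e, RelIso.inv_apply_self]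
    have t1 := fun s => fix s _ _ (hr2 s) (hr2' s)
    have t2 := fun s => fix s _ _ (hr3 s) (hr3' s)
    obtain ⟨τ, hτ⟩ := exists_iso_glue_spikes hT hval β.perfect_R f
      (fun s => (r s)⁻¹ * w⁻¹ * r' s * u) t1 t2
    refine ⟨w, τ * u⁻¹, fun y => ?_⟩
    obtain ⟨x, rfl⟩ : ∃ x, bdryMap u x = y := ⟨_, bdryMap_bdryMap_inv u y⟩
    obtain ⟨s, hs⟩ := exists_mem_spikeBall hT hval β.perfect_R f x
    have hux : bdryMap u x ∈ spikeBall f' s := by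
      have := bdryMap_mem_ball u hs
      rwa [hu, hu] at this
    have htx : bdryMap ((r s)⁻¹ * w⁻¹ * r' s * u) x ∈ spikeBall f s := by
      have := bdryMap_mem_ball ((r s)⁻¹ * w⁻¹ * r' s * u) hs
      rwa [t1, t2] at this
    rw [bdryMap_mul, bdryMap_inv_bdryMap, bdryMap_congr (hτ s) hs, hr1 s _ htx, hr1' s _ hux,
      bdryMap_mul, bdryMap_mul, bdryMap_mul, bdryMap_bdryMap_inv, bdryMap_bdryMap_inv]

/-! ### Existence of the bi-thorn -/

theorem regards_symm {g : Bdry T ≃ₜ Bdry T} (hT : T.IsTree) (hval : ∀ v, valence T v = n + 1)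
    {B : Set (Bdry T)} (h : Regards T g B) : Regards T g.symm (g '' B) := by
  obtain ⟨p, q, hpq, rfl, r, hr⟩ := (regards_iff hT hval g B).1 h
  refine (regards_iff hT hval _ _).2
    ⟨r p, r q, r.map_adj_iff.2 hpq, image_ball_of_eqOn hr, r⁻¹, ?_⟩
  rw [← image_ball]
  rintro _ ⟨x, hx, rfl⟩
  rw [← hr x hx, g.symm_apply_apply, hr x hx, bdryMap_inv_bdryMap]

theorem regards_symm_iff {g : Bdry T ≃ₜ Bdry T} (hT : T.IsTree)
    (hval : ∀ v, valence T v = n + 1) (B : Set (Bdry T)) :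
    Regards T g B ↔ Regards T g.symm (g.toEquiv '' B) := by
  refine ⟨regards_symm hT hval, fun h => ?_⟩
  have h' := regards_symm hT hval h
  have e : g.symm '' (g.toEquiv '' B) = B := g.toEquiv.symm_image_image B
  rw [e] at h'
  exact h'

/-- The empty thorn. -/
def emptyThorn (n : ℕ) : Thorn n := ⟨Empty, ⊥, inferInstance, Or.inl inferInstance⟩

/-- The thorns are the cores of `g` and `g⁻¹`, with the edges that leave them. -/
theorem exists_isBiThornOf (hT : T.IsTree) (hn : 2 ≤ n) (hval : ∀ v, valence T v = n + 1)
    {g : Bdry T ≃ₜ Bdry T} (hg : g ∈ Hier T) : ∃ β : BiThorn n, IsBiThornOf g β := by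
  by_cases hng : IsAut g
  · obtain ⟨f⟩ := exists_embedding_thorn hT hval (emptyThorn n)
    refine ⟨⟨emptyThorn n, emptyThorn n, fun v => v.1.elim, fun v => v.1.elim, rfl, .refl _⟩,
      isBiThornOf_iff.2 ⟨f, f, fun B => ?_, fun s => s.1.elim⟩⟩
    exact ⟨fun hB => absurd hB (not_maximal_of_isAut hT hn hval hng B),
      fun ⟨s, _⟩ => s.1.elim⟩
  · have hg' : g.symm ∈ Hier T := (Hier T).inv_mem hg
    have hng' : ¬ IsAut g.symm := by
      rintro ⟨r, hr⟩
      refine hng ⟨r⁻¹, fun x => ?_⟩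
      have := hr (g x)
      rw [g.symm_apply_apply] at this
      conv_rhs => rw [this]
      rw [bdryMap_inv_bdryMap]
    obtain ⟨R, f, hR, hRne, hf⟩ := exists_thorn hT hn hval (core_finite hT hval hg)
      (core_nonempty hT hn hval hg hng) (isConvex_core hT g)
    obtain ⟨Q, h, hQ, hQne, hh⟩ := exists_thorn hT hn hval (core_finite hT hval hg')
      (core_nonempty hT hn hval hg' hng') (isConvex_core hT g.symm)
    have max : ∀ {g : Bdry T ≃ₜ Bdry T} {R : Thorn n} {f : R.graph ↪g T}, ¬ IsAut g →
        R.IsPerfect → verts f = core g →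
        ∀ B, Maximal (Regards T g) B ↔ ∃ s, B = spikeBall f s := by
      intro g R f hng hR hf B
      rw [maximal_regards_iff hT hn hval hng, ← hf]
      constructor
      · rintro ⟨v, hv, x, hx, hvx, rfl⟩
        obtain ⟨s, rfl, rfl⟩ := (exit_verts_iff hval hR f).1 ⟨hv, hx, hvx⟩
        exact ⟨s, rfl⟩
      · rintro ⟨s, rfl⟩
        obtain ⟨h1, h2, h3⟩ := (exit_verts_iff hval hR f).2 ⟨s, rfl, rfl⟩
        exact ⟨_, h1, _, h2, h3, rfl⟩
    have hmax := max hng hR hf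
    have hmax' := max hng' hQ hh
    have hmm := maximal_image_iff g.toEquiv (regards_symm_iff (g := g) hT hval)
    have hθ : ∀ s, ∃ t, g '' spikeBall f s = spikeBall h t := fun s =>
      (hmax' _).1 ((hmm _).1 ((hmax _).2 ⟨s, rfl⟩))
    choose θ hθ using hθ
    have hbij : Function.Bijective θ := by
      constructor
      · intro s s' e
        have := (hθ s).trans ((congrArg _ e).trans (hθ s').symm)
        exact spikeBall_injective hT hn hval f (g.injective.image_injective this)
      · intro t
        have e : g.toEquiv '' (g.toEquiv.symm '' spikeBall h t) = spikeBall h t :=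
          g.toEquiv.image_symm_image _
        obtain ⟨s, hs⟩ := (hmax _).1 ((hmm _).2 (e.symm ▸ (hmax' _).2 ⟨t, rfl⟩))
        rw [hs] at e
        exact ⟨s, spikeBall_injective hT hn hval h ((hθ s).symm.trans e)⟩
    have hcard : Nat.card R.Vert = Nat.card Q.Vert := by
      have h1 := Thorn.card_spike hR
      have h2 := Thorn.card_spike hQ
      rw [← Nat.card_congr (Equiv.ofBijective θ hbij)] at h2
      obtain ⟨m, rfl⟩ := Nat.exists_eq_add_of_le' (show 1 ≤ n by omega)
      rw [show m + 1 + 1 = m + 2 by rfl, add_mul] at h1 h2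
      exact Nat.eq_of_mul_eq_mul_left (show 0 < m by omega) (by omega)
    exact ⟨⟨R, Q, hR, hQ, hcard, Equiv.ofBijective θ hbij⟩, isBiThornOf_iff.2 ⟨f, h, hmax, hθ⟩⟩

/-! ### Realization of minimal bi-thorns -/

/-- Homeomorphisms between the pieces of two open partitions can be glued. -/
theorem exists_homeomorph_glue {X Y ι : Type*} [TopologicalSpace X] [TopologicalSpace Y]
    {A : ι → Set X} {B : ι → Set Y} (hA : ∀ i, IsOpen (A i)) (hB : ∀ i, IsOpen (B i))
    (cA : ∀ x, ∃ i, x ∈ A i) (cB : ∀ y, ∃ i, y ∈ B i)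
    (dA : ∀ x i j, x ∈ A i → x ∈ A j → i = j) (dB : ∀ y i j, y ∈ B i → y ∈ B j → i = j)
    (r : ι → X ≃ₜ Y) (hr : ∀ i, r i '' A i = B i) :
    ∃ g : X ≃ₜ Y, ∀ i, ∀ x ∈ A i, g x = r i x := by
  choose iA hiA using cA
  choose iB hiB using cB
  have hF : ∀ i, ∀ x ∈ A i, r (iA x) x = r i x := fun i x hx => by
    rw [dA x _ _ (hiA x) hx]
  have hG : ∀ i, ∀ y ∈ B i, (r (iB y)).symm y = (r i).symm y := fun i y hy => by
    rw [dB y _ _ (hiB y) hy]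
  have hAB : ∀ i, ∀ x ∈ A i, r i x ∈ B i := fun i x hx => hr i ▸ Set.mem_image_of_mem _ hx
  have hBA : ∀ i, ∀ y ∈ B i, (r i).symm y ∈ A i := by
    intro i y hy
    rw [← hr i] at hy
    obtain ⟨x, hx, rfl⟩ := hy
    rwa [(r i).symm_apply_apply]
  refine ⟨⟨⟨fun x => r (iA x) x, fun y => (r (iB y)).symm y, fun x => ?_, fun y => ?_⟩, ?_, ?_⟩,
    hF⟩
  · change (r (iB (r (iA x) x))).symm (r (iA x) x) = x
    rw [hG (iA x) _ (hAB _ x (hiA x)), Homeomorph.symm_apply_apply]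
  · change r (iA ((r (iB y)).symm y)) ((r (iB y)).symm y) = y
    rw [hF (iB y) _ (hBA _ y (hiB y)), Homeomorph.apply_symm_apply]
  · refine continuous_iff_continuousAt.2 fun x => ?_
    exact (r (iA x)).continuous.continuousAt.congr
      (Filter.mem_of_superset ((hA _).mem_nhds (hiA x)) fun z hz => (hF _ z hz).symm)
  · refine continuous_iff_continuousAt.2 fun y => ?_
    exact (r (iB y)).symm.continuous.continuousAt.congr
      (Filter.mem_of_superset ((hB _).mem_nhds (hiB y)) fun z hz => (hG _ z hz).symm)

/-- If `g` coincides with an automorphism behind an edge, and the branch there contains a vertex of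
the thorn, then the bi-thorn has a pair of similar vertices. -/
theorem notMem_branch_of_isMinimal (hT : T.IsTree) (hn : 2 ≤ n)
    (hval : ∀ v, valence T v = n + 1) {g : Bdry T ≃ₜ Bdry T} {β : BiThorn n} (hβ : β.IsMinimal)
    {f : β.R.graph ↪g T} {h : β.Q.graph ↪g T}
    (him : ∀ s, g '' spikeBall f s = spikeBall h (β.θ s)) {p q : V} (hpq : T.Adj p q)
    (hag : AgreesOn g p q) {v : V} (hv : v ∈ verts f) : v ∉ branch T p q := by
  intro hvb
  obtain ⟨_, ⟨c, hc, rfl⟩, p', hp', hb, hterm⟩ :=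
    exists_terminal hT (verts_finite f) hpq ⟨v, hv, hvb⟩
  have hcv : f c ∈ verts f := ⟨c, hc, rfl⟩
  obtain ⟨ρ, hρ⟩ := hag.mono hb
  have spike : ∀ y, T.Adj (f c) y → y ≠ p' →
      ∃ s : β.R.Spike, f c = f (Thorn.foot s).1 ∧ y = f s.1 := fun y hy hyp =>
    (exit_verts_iff hval β.perfect_R f).1 ⟨hcv, hterm y hy hyp, hy⟩
  have image : ∀ s : β.R.Spike, f c = f (Thorn.foot s).1 → f s.1 ≠ p' →
      ρ (f c) = h (Thorn.foot (β.θ s)).1 ∧ ρ (f s.1) = h (β.θ s).1 := by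
    intro s hs hsp
    have hadj : T.Adj (f c) (f s.1) := hs ▸ adj_spike f s
    refine ball_inj hT hn hval (ρ.map_adj_iff.2 hadj) (adj_spike h _) ?_
    rw [← image_ball_of_eqOn
      (fun x hx => hρ x (ball_mono (branch_nested hT hp' hadj hsp) hx)), hs]
    exact him s
  obtain ⟨y, hy, hyp, -⟩ := exists_adj_ne_ne hn hval (f c) p' p'
  obtain ⟨s₀, hs₀, rfl⟩ := spike y hy hyp
  have hb₀ := (image s₀ hs₀ hyp).1
  refine hβ ⟨c, hc⟩ (Thorn.foot (β.θ s₀)) ⟨?_, ?_, ?_⟩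
  · have key : ∀ w : β.R.Vert, β.R.graph.Adj c w.1 → f w.1 = p' := by
      intro w hw
      by_contra hne
      exact hterm _ (f.map_adj_iff.2 hw) hne ⟨w.1, w.2, rfl⟩
    refine (Set.ncard_le_one (Set.toFinite _)).2 fun w hw w' hw' => ?_
    exact Subtype.ext (f.injective ((key w hw).trans (key w' hw').symm))
  · -- only the image of the edge to `p'` can end in a vertex
    have key : ∀ w : β.Q.Vert, β.Q.graph.Adj (Thorn.foot (β.θ s₀)).1 w.1 → h w.1 = ρ p' := by
      intro w hw
      have h1 : T.Adj (ρ (f c)) (h w.1) := hb₀ ▸ h.map_adj_iff.2 hw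
      have h2 : T.Adj (f c) (ρ⁻¹ (h w.1)) := by
        rwa [← ρ.map_adj_iff, RelIso.apply_inv_self]
      by_contra hne
      obtain ⟨s, hs, e⟩ := spike _ h2 (fun e => hne (by rw [← e, RelIso.apply_inv_self]))
      have h3 := (image s hs (fun e' => hne (by rw [← e', ← e, RelIso.apply_inv_self]))).2
      rw [← e, RelIso.apply_inv_self] at h3
      exact w.2 (h.injective h3 ▸ (β.θ s).2)
    refine (Set.ncard_le_one (Set.toFinite _)).2 fun w hw w' hw' => ?_
    exact Subtype.ext (h.injective ((key w hw).trans (key w' hw').symm))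
  · intro s hs
    have hfoot : f c = f (Thorn.foot s).1 := congrArg f (Thorn.eq_foot hs)
    suffices Thorn.foot (β.θ s₀) = Thorn.foot (β.θ s) by
      rw [this]; exact Thorn.foot_adj _
    by_cases hsp : f s.1 = p'
    · -- all neighbours of `c` are spikes, so each thorn has a single vertex
      have hall : ∀ y, T.Adj (f c) y → y ∉ verts f := by
        intro y hy
        by_cases e : y = p'
        · rw [e, ← hsp]
          exact fun h' => (mem_verts f).1 h' s.2
        · exact hterm y hy e
      have hone : ∀ w : β.R.Vert, w = ⟨c, hc⟩ := by
        intro w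
        by_contra hw
        obtain ⟨y, hy, hwy⟩ := exists_adj_branch hT (p := f w.1) (y := f c)
          (fun e => hw (Subtype.ext (f.injective e)))
        exact (notMem_branch_iff hT hy).2 (isConvex_verts hT hval β.perfect_R f _ hcv y
          (hall y hy) hy ⟨w.1, w.2, rfl⟩) hwy
      have hcard : Nat.card β.Q.Vert = 1 := by
        rw [← β.card_eq, Nat.card_eq_one_iff_exists]
        exact ⟨_, hone⟩
      obtain ⟨b, hb⟩ := Nat.card_eq_one_iff_exists.1 hcard
      rw [hb (Thorn.foot (β.θ s₀)), hb (Thorn.foot (β.θ s))]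
    · exact Subtype.ext (h.injective (hb₀.symm.trans (image s hfoot hsp).1))

/-- Each minimal bi-thorn is the bi-thorn of a spheromorphism. -/
theorem exists_hier_of_isMinimal (hT : T.IsTree) (hn : 2 ≤ n) (hval : ∀ v, valence T v = n + 1)
    {β : BiThorn n} (hβ : β.IsMinimal) : ∃ g ∈ Hier T, IsBiThornOf (T := T) g β := by
  obtain ⟨f⟩ := exists_embedding_thorn hT hval β.R
  obtain ⟨h⟩ := exists_embedding_thorn hT hval β.Q
  rcases isEmpty_or_nonempty β.R.carrier with hE | hN
  · refine ⟨1, (Hier T).one_mem, isBiThornOf_iff.2 ⟨f, h, fun B => ?_, fun s => hE.elim s.1⟩⟩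
    exact ⟨fun hB => absurd hB (not_maximal_of_isAut hT hn hval
      ⟨1, fun x => (bdryMap_one x).symm⟩ B), fun ⟨s, _⟩ => hE.elim s.1⟩
  have := (nonempty_R_iff β).1 hN
  choose r hr1 hr2 using fun s : β.R.Spike =>
    exists_iso_edge hT hval (adj_spike f s) (adj_spike h (β.θ s))
  have hrs : ∀ s, autBdry T (r s) '' spikeBall f s = spikeBall h (β.θ s) := by
    intro s
    have := image_ball (r s) (f (Thorn.foot s).1) (f s.1)
    rw [hr1, hr2] at this
    exact this
  obtain ⟨g, hg⟩ := exists_homeomorph_glue (A := spikeBall f) (B := fun s => spikeBall h (β.θ s))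
    (fun s => isOpen_ball (adj_spike f s)) (fun s => isOpen_ball (adj_spike h _))
    (exists_mem_spikeBall hT hval β.perfect_R f)
    (fun y => by
      obtain ⟨t, ht⟩ := exists_mem_spikeBall hT hval β.perfect_Q h y
      exact ⟨β.θ.symm t, by rwa [Equiv.apply_symm_apply]⟩)
    (fun x s s' => eq_of_mem_spikeBall hT hval β.perfect_R f)
    (fun y s s' h1 h2 => β.θ.injective (eq_of_mem_spikeBall hT hval β.perfect_Q h h1 h2))
    (fun s => autBdry T (r s)) hrs
  have hag : ∀ s, AgreesOn g (f (Thorn.foot s : β.R.Vert).1) (f s.1) := fun s =>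
    ⟨r s, fun x hx => hg s x hx⟩
  have him : ∀ s, g '' spikeBall f s = spikeBall h (β.θ s) := fun s =>
    (Set.image_congr (hg s)).trans (hrs s)
  refine ⟨g, mem_hier_of_agreesOn fun x => ?_, isBiThornOf_iff.2 ⟨f, h, fun B => ⟨?_, ?_⟩, him⟩⟩
  · obtain ⟨s, hs⟩ := exists_mem_spikeBall hT hval β.perfect_R f x
    exact ⟨_, _, adj_spike f s, hs, hag s⟩
  · intro hB
    obtain ⟨p, q, hpq, rfl, hpqa⟩ := (regards_iff hT hval g B).1 hB.prop
    have hout : ∀ v ∈ verts f, v ∉ branch T p q := fun v hv =>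
      notMem_branch_of_isMinimal hT hn hval hβ him hpq hpqa hv
    have hq : q ∉ verts f := fun hq => hout q hq (mem_branch_self p q)
    rw [mem_verts_iff hT hval β.perfect_R] at hq
    push Not at hq
    obtain ⟨s, hs⟩ := hq
    refine ⟨s, Set.Subset.antisymm ?_ ?_⟩
    · exact ball_mono (branch_subset hT (adj_spike f s) (hout _ ⟨_, (Thorn.foot s).2, rfl⟩)
        (mem_branch_self _ _) hs)
    · exact hB.le_of_ge ((regards_iff hT hval g _).2 ⟨_, _, adj_spike f s, rfl, hag s⟩)
        (ball_mono (branch_subset hT (adj_spike f s) (hout _ ⟨_, (Thorn.foot s).2, rfl⟩)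
          (mem_branch_self _ _) hs))
  · rintro ⟨s, rfl⟩
    refine ⟨(regards_iff hT hval g _).2 ⟨_, _, adj_spike f s, rfl, hag s⟩, ?_⟩
    intro B' hB' hle
    obtain ⟨p, q, hpq, rfl, hpqa⟩ := (regards_iff hT hval g B').1 hB'
    have hout := notMem_branch_of_isMinimal hT hn hval hβ him hpq hpqa
      (v := f (Thorn.foot s).1) ⟨_, (Thorn.foot s).2, rfl⟩
    have hin := (ball_subset_iff hT hn hval (adj_spike f s) hpq).1 hle (mem_branch_self _ _)
    obtain ⟨e1, e2⟩ := branch_exit hT hpq hin hout (adj_spike f s).symm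
    rw [spikeBall, e1, e2]

theorem doubleCoset_mk_eq_iff (g g' : Hier T) :
    DoubleCoset.mk (AutSubgroup T) (AutSubgroup T) g =
      DoubleCoset.mk (AutSubgroup T) (AutSubgroup T) g' ↔
    ∃ a b : T ≃g T, ∀ x, g'.1 x = bdryMap a (g.1 (bdryMap b x)) := by
  have mem : ∀ r : T ≃g T, autBdry T r ∈ Hier T := fun r y =>
    ⟨Set.univ, Filter.univ_mem, r, fun _ _ => rfl⟩
  rw [DoubleCoset.eq]
  constructor
  · rintro ⟨⟨_, _⟩, ⟨a, rfl⟩, ⟨_, _⟩, ⟨b, rfl⟩, rfl⟩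
    exact ⟨a, b, fun x => rfl⟩
  · rintro ⟨a, b, hab⟩
    exact ⟨⟨autBdry T a, mem a⟩, ⟨a, rfl⟩, ⟨autBdry T b, mem b⟩, ⟨b, rfl⟩,
      Subtype.ext (Homeomorph.ext hab)⟩

end BiThorns

end Spheromorphism

open Spheromorphism in
theorem proposition3 {V : Type*} (T : SimpleGraph V) [T.LocallyFinite] (n : ℕ) (hn : 2 ≤ n)
    (hT : T.IsTree) (hreg : T.IsRegularOfDegree (n + 1)) :
    ∃! Φ : DoubleCoset.Quotient (AutSubgroup T : Set (Hier T)) (AutSubgroup T : Set (Hier T)) ≃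
        MinimalBiThorn n,
      ∀ (g : Hier T) (β : BiThorn n) (hβ : β.IsMinimal),
        Φ (DoubleCoset.mk (AutSubgroup T) (AutSubgroup T) g) = MinimalBiThorn.mk β hβ ↔
          IsBiThornOf (g : Bdry T ≃ₜ Bdry T) β := by
  have hval := valence_of_regular hreg
  have hex : ∀ g : Hier T, ∃ β : BiThorn n, IsBiThornOf g.1 β := fun g =>
    exists_isBiThornOf hT hn hval g.2
  choose β hβ using hex
  have hmin : ∀ g, (β g).IsMinimal := fun g => isMinimal_of_isBiThornOf hT hn hval (hβ g)
  let Φ : DoubleCoset.Quotient (AutSubgroup T : Set (Hier T)) (AutSubgroup T : Set (Hier T)) →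
      MinimalBiThorn n := Quotient.lift (fun g => MinimalBiThorn.mk (β g) (hmin g)) (by
    intro g g' hgg
    have hgg' : DoubleCoset.mk (AutSubgroup T) (AutSubgroup T) g =
      DoubleCoset.mk (AutSubgroup T) (AutSubgroup T) g' := Quotient.sound hgg
    obtain ⟨a, b, hab⟩ := (doubleCoset_mk_eq_iff g g').1 hgg'
    exact Quotient.sound (isomorphic_of_isBiThornOf hT hn hval
      (isBiThornOf_comp hT hval hab (hβ g)) (hβ g')))
  have hΦ : ∀ (g : Hier T) (γ : BiThorn n) (hγ : γ.IsMinimal),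
      Φ (DoubleCoset.mk (AutSubgroup T) (AutSubgroup T) g) = MinimalBiThorn.mk γ hγ ↔
        IsBiThornOf (g : Bdry T ≃ₜ Bdry T) γ := by
    intro g γ hγ
    constructor
    · intro e
      have e' : BiThorn.Isomorphic (β g) γ := Quotient.exact e
      exact isBiThornOf_of_isomorphic e' (hβ g)
    · exact fun h => Quotient.sound (isomorphic_of_isBiThornOf hT hn hval (hβ g) h)
  have hbij : Function.Bijective Φ := by
    constructor
    · intro x x' e
      induction x using Quotient.inductionOn with
      | h g =>
      induction x' using Quotient.inductionOn with
      | h g' =>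
      have h' : IsBiThornOf g.1 (β g') := (hΦ g (β g') (hmin g')).1 e
      exact (doubleCoset_mk_eq_iff g g').2
        (exists_comp_of_isBiThornOf hT hn hval g.2 g'.2 h' (hβ g'))
    · intro y
      induction y using Quotient.inductionOn with
      | h γ =>
      obtain ⟨g, hg, hgγ⟩ := exists_hier_of_isMinimal hT hn hval γ.2
      exact ⟨DoubleCoset.mk _ _ ⟨g, hg⟩, (hΦ ⟨g, hg⟩ γ.1 γ.2).2 hgγ⟩
  refine ⟨Equiv.ofBijective Φ hbij, hΦ, fun Ψ hΨ => Equiv.ext fun x => ?_⟩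
  induction x using Quotient.inductionOn with
  | h g => exact (hΨ g (β g) (hmin g)).2 (hβ g)
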